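/- **Setting.** Let $(\mathcal Y,d)$ be a metric space, $\mathcal X\subseteq\mathcal Y$ a finite set, $p\ge 1$, and let $\mu_1,\dots,\mu_N$ ($N\ge1$) be probability measures on $\mathcal X$. For probability measures $\mu,\nu$ on $\mathcal Y$ let $W_p^p(\mu,\nu)=\inf_\pi\int d(x,y)^p\,d\pi(x,y)$ over all couplings $\pi$ of $\mu$ and $\nu$. A *centroid* of $(x_1,\dots,x_N)$ is a minimiser of $y\mapsto\sum_i d(x_i,y)^p$ over $\mathcal Y$; let $\mathcal C_{\rm all}$ be the set of all centroids of all tuples with $x_i\in\mathrm{supp}(\mu_i)$ for every $i$. Let $\mathcal C\subseteq\mathcal C_{\rm all}$ be finite and contain at least one centroid of each such tuple. Barycenters of $N$ measures $\nu_1,\dots,\nu_N$ are the minimisers of $\mu\mapsto\frac1N\sum_i W_p^p(\nu_i,\mu)$, either over all probability measures on $\mathcal C$, or, if $\mathcal C=\mathcal C_{\rm all}$, over all Borel probability measures on $\mathcal Y$ (the theorem holds for both readings). Put $\Delta=\mathrm{diam}(\mathcal X\cup\mathcal C)$. For each $i$ let $\mu_i^S$ be the empirical measure of $S\ge 1$ i.i.d.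 draws from $\mu_i$. Let $\mathbf B^*$ be the set of barycenters of $\mu_1,\dots,\mu_N$ and $\mathbf B_S^*$ that of $\mu_1^S,\dots,\mu_N^S$. Let $P$ be the polytope of all $z=(\pi^{(1)},\dots,\pi^{(N)},a)$ with $\pi^{(i)}\in\mathbb R_{\ge0}^{\mathcal C\times \mathrm{supp}(\mu_i)}$, $a\in\mathbb R^{\mathcal C}$, $\sum_{k}\pi^{(i)}_{jk}=a_j$ and $\sum_{j}\pi^{(i)}_{jk}=\mu_i(\{k\})$ for all $i$, all $j\in\mathcal C$ and all $k\in\mathrm{supp}(\mu_i)$. Let $c^Tz=\frac1N\sum_{i,j,k}\pi^{(i)}_{jk}\,d(j,k)^p$, let $f^*$ be its minimum over $P$, $\mathcal M$ the set of minimisers, $V$ the vertex set of $P$, $V^*=V\cap\mathcal M$, $d_1(v,\mathcal M)=\inf_{x\in\mathcal M}\|v-x\|_1$, and $$C_P=(N+1)\,\Delta^{-p}\min_{v\in V\setminus V^*}\frac{c^Tv-f^*}{d_1(v,\mathcal M)}$$ (with $C_P=+\infty$ if $V=V^*$). Finally let $\bar{\mathcal E}=\frac1N\sum_i\mathcal E(\mathrm{supp}(\mu_i))$,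 where for a nonempty finite set $K\subseteq\mathcal Y$ $$\mathcal E(K)=\inf_{q>1,\;L\in\mathbb N_0} q\Big[q^{-(L+1)}|K|^{1/2}+\sum_{l=1}^{L}q^{-l}\sqrt{\mathcal N\big(K,q^{-l}\mathrm{diam}(K)\big)}\Big]$$ and $\mathcal N(K,\delta)$ is the least number of closed balls of radius $\delta$ with centres in $K$ that cover $K$. **Theorem.** $\mathbf B^*$ is nonempty, $\mathbf B^*_S$ is almost surely nonempty, $C_P>0$, and $$\mathbb E\Big[\sup_{\widehat\mu\in\mathbf B_S^*}\ \inf_{\mu^*\in\mathbf B^*}W_p^p(\mu^*,\widehat\mu)\Big]\le\frac{p\,\bar{\mathcal E}\,\Delta^p}{C_P}\,S^{-1/2}$$ (if $V=V^*$ the left-hand side is $0$). If $\mathcal Y$ is isometric to a convex subset of a Euclidean space $\mathbb R^D$, then $\Delta=\mathrm{diam}(\mathcal X)$. -/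

import Mathlib

open MeasureTheory ProbabilityTheory
open scoped ENNReal NNReal

noncomputable section

namespace WassersteinBarycenter

/-! ### Optimal transport, Fréchet functional, barycenters -/

/-- The couplings of two Borel measures. -/
def couplings {Y : Type*} [MeasurableSpace Y] (μ ν : Measure Y) : Set (Measure (Y × Y)) :=
  {π | π.fst = μ ∧ π.snd = ν}

/-- The `p`-Wasserstein distance (with values in `[0, ∞]`). -/
def wasserstein {Y : Type*} [MetricSpace Y] [MeasurableSpace Y] (p : ℝ) (μ ν : Measure Y) :
    ℝ≥0∞ :=
  (⨅ π ∈ couplings μ ν, ∫⁻ z, edist z.1 z.2 ^ p ∂π) ^ (1 / p)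

/-- The `p`-Fréchet functional `ν ↦ N⁻¹ ∑ᵢ W_p(μᵢ, ν)^p`. -/
def frechet {Y : Type*} [MetricSpace Y] [MeasurableSpace Y] {N : ℕ} (p : ℝ)
    (μ : Fin N → Measure Y) (ν : Measure Y) : ℝ≥0∞ :=
  (N : ℝ≥0∞)⁻¹ * ∑ i, wasserstein p (μ i) ν ^ p

/-- The probability measures on `Y` that are concentrated on `A`. -/
def probOn {Y : Type*} [MeasurableSpace Y] (A : Set Y) : Set (Measure Y) :=
  {ν | IsProbabilityMeasure ν ∧ ν Aᶜ = 0}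

/-- The minimisers of the `p`-Fréchet functional over the probability measures on `A`. For
`A = Set.univ` these are all the `p`-Wasserstein barycenters in `Y`. -/
def barycenters {Y : Type*} [MetricSpace Y] [MeasurableSpace Y] {N : ℕ} (p : ℝ) (A : Set Y)
    (μ : Fin N → Measure Y) : Set (Measure Y) :=
  {ν | ν ∈ probOn A ∧ ∀ ρ ∈ probOn A, frechet p μ ν ≤ frechet p μ ρ}

/-- The empirical measure of a sample `x₁, …, x_S`. -/
def empirical {Y : Type*} [MeasurableSpace Y] {S : ℕ} (x : Fin S → Y) : Measure Y :=
  (S : ℝ≥0∞)⁻¹ • ∑ k, Measure.dirac (x k)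

open Classical in
/-- The support of a measure that lives on the finite set `X`: the points of positive mass. -/
def supp {Y : Type*} [MeasurableSpace Y] (X : Finset Y) (μ : Measure Y) : Finset Y :=
  X.filter (fun x => μ {x} ≠ 0)

/-! ### Centroids -/

/-- `y` minimises `∑ᵢ d(xᵢ, ·)^p` over the whole space. -/
def IsCentroid {Y : Type*} [MetricSpace Y] {N : ℕ} (p : ℝ) (x : Fin N → Y) (y : Y) : Prop :=
  ∀ z, ∑ i, dist (x i) y ^ p ≤ ∑ i, dist (x i) z ^ p

/-- The `p`-centroid set of finite sets `s₁, …, s_N`: all the minimisers of `∑ᵢ d(xᵢ, ·)^p`, for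
all the choices `xᵢ ∈ sᵢ`. -/
def centroidSet {Y : Type*} [MetricSpace Y] {N : ℕ} (p : ℝ) (s : Fin N → Finset Y) : Set Y :=
  {y | ∃ x : Fin N → Y, (∀ i, x i ∈ s i) ∧ IsCentroid p x y}

/-! ### The linear program over the finite set `C` -/

/-- The variables `(π⁽¹⁾, …, π⁽ᴺ⁾, a)` with `π⁽ⁱ⁾ ∈ ℝ^(C × sᵢ)` and `a ∈ ℝ^C`. -/
abbrev LPVar {Y : Type*} {N : ℕ} (C : Finset Y) (s : Fin N → Finset Y) : Type _ :=
  ((i : Fin N) → C → s i → ℝ) × (C → ℝ)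

/-- The feasible polytope. -/
def lpFeasible {Y : Type*} [MeasurableSpace Y] {N : ℕ} (C : Finset Y) (s : Fin N → Finset Y)
    (μ : Fin N → Measure Y) : Set (LPVar C s) :=
  {z | (∀ i j, ∑ k, z.1 i j k = z.2 j) ∧
       (∀ i (k : s i), ∑ j, z.1 i j k = (μ i).real {(k : Y)}) ∧
       (∀ i j k, 0 ≤ z.1 i j k)}

/-- The linear objective `c ⬝ z`. -/
def lpCost {Y : Type*} [MetricSpace Y] {N : ℕ} (p : ℝ) (C : Finset Y) (s : Fin N → Finset Y)
    (z : LPVar C s) : ℝ :=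
  (1 / (N : ℝ)) * ∑ i, ∑ j : C, ∑ k : s i, z.1 i j k * dist (j : Y) (k : Y) ^ p

/-- The optimal value of the program. -/
def lpValue {Y : Type*} [MetricSpace Y] [MeasurableSpace Y] {N : ℕ} (p : ℝ) (C : Finset Y)
    (s : Fin N → Finset Y) (μ : Fin N → Measure Y) : ℝ :=
  sInf (lpCost p C s '' lpFeasible C s μ)

/-- The set of minimisers of the program. -/
def lpMinimisers {Y : Type*} [MetricSpace Y] [MeasurableSpace Y] {N : ℕ} (p : ℝ) (C : Finset Y)
    (s : Fin N → Finset Y) (μ : Fin N → Measure Y) : Set (LPVar C s) :=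
  {z | z ∈ lpFeasible C s μ ∧ ∀ w ∈ lpFeasible C s μ, lpCost p C s z ≤ lpCost p C s w}

/-- The non-optimal vertices of the feasible polytope. -/
def lpNonoptVertices {Y : Type*} [MetricSpace Y] [MeasurableSpace Y] {N : ℕ} (p : ℝ)
    (C : Finset Y) (s : Fin N → Finset Y) (μ : Fin N → Measure Y) : Set (LPVar C s) :=
  (lpFeasible C s μ).extremePoints ℝ \ lpMinimisers p C s μ

/-- The `ℓ¹` distance between two vectors of variables. -/
def lpDist {Y : Type*} {N : ℕ} {C : Finset Y} {s : Fin N → Finset Y} (z w : LPVar C s) : ℝ :=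
  ∑ i, ∑ j, ∑ k, |z.1 i j k - w.1 i j k| + ∑ j, |z.2 j - w.2 j|

/-- The `ℓ¹` distance from a vector to a set. -/
def lpDistTo {Y : Type*} {N : ℕ} {C : Finset Y} {s : Fin N → Finset Y} (z : LPVar C s)
    (M : Set (LPVar C s)) : ℝ :=
  sInf ((fun w => lpDist z w) '' M)

/-- `(N + 1) Δ^(-p) · min (c ⬝ v - f*) / d₁(v, M)`, the minimum over the non-optimal vertices `v`.
(If there is no such vertex then this is `0` by the convention `sInf ∅ = 0`; that case has to be
treated separately.) -/
def lpConst {Y : Type*} [MetricSpace Y] [MeasurableSpace Y] {N : ℕ} (p Δ : ℝ)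
    (C : Finset Y) (s : Fin N → Finset Y) (μ : Fin N → Measure Y) : ℝ :=
  ((N : ℝ) + 1) * Δ ^ (-p) *
    sInf ((fun v => (lpCost p C s v - lpValue p C s μ) / lpDistTo v (lpMinimisers p C s μ)) ''
      lpNonoptVertices p C s μ)

/-! ### The covering constant -/

/-- `inf_{q > 1, L ≥ 0} q (q^(-(L+1)) |A|^(1/2) + ∑_{l=1}^L q^(-l) 𝒩(A, q^(-l) diam A)^(1/2))`,
with `𝒩(A, δ)` the least number of closed balls of radius `δ` with centres in `A` that cover `A`. -/
def coverConst {Y : Type*} [MetricSpace Y] (A : Finset Y) : ℝ :=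
  ⨅ t : {q : ℝ // 1 < q} × ℕ,
    (t.1 : ℝ) * (((t.1 : ℝ) ^ (t.2 + 1))⁻¹ * √(A.card : ℝ) +
      ∑ l ∈ Finset.Icc 1 t.2, ((t.1 : ℝ) ^ l)⁻¹ *
        √(((Metric.coveringNumber
            (Real.toNNReal (((t.1 : ℝ) ^ l)⁻¹ * Metric.diam (A : Set Y))) (A : Set Y)).toNat : ℝ)))

/-- The average of the covering constants of `s₁, …, s_N`. -/
def avgCoverConst {Y : Type*} [MetricSpace Y] {N : ℕ} (s : Fin N → Finset Y) : ℝ :=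
  (∑ i, coverConst (s i)) / (N : ℝ)

/-- `Y` is isometric to a convex subset of a Euclidean space. -/
def IsConvexEuclidean (Y : Type*) [MetricSpace Y] : Prop :=
  ∃ (D : ℕ) (f : Y → EuclideanSpace ℝ (Fin D)), Isometry f ∧ Convex ℝ (Set.range f)

end WassersteinBarycenter

end

open WassersteinBarycenter

set_option linter.unusedSectionVars false

/-! A measure on the finite set `C` is a barycenter exactly when it is the weight part `a` of a
minimiser of the linear program (`mem_barycenters_finset_iff`). So the theorem amounts to stability
of this program under a change of marginals, together with a bound on the mean transport cost from
the empirical to the true marginals.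

Stability (`exists_barycenter_close`). Let `T i` bound the cost, for the distance itself, of moving
the `i`-th empirical marginal to the true one. As `t ↦ t ^ p` is Lipschitz with constant `p Δ ^ (p -
1)` on `[0, Δ]`, gluing such plans to a feasible point exchanges its marginals, keeps `a`, and
raises the objective by at most `ε`, which is `p Δ ^ (p - 1)` times the mean of the `T i`. Doing
this to an empirical minimiser, and in the other direction to a true one, puts the weights of any
empirical barycenter into a true feasible point of value at most `f* + 2ε`. The polytope is the hull
of finitely many vertices, so the objective exceeds `f*` by at least the least vertex slope times
the `ℓ¹` distance to the minimisers (`exists_lpSlope_mul_lpDist_le`). That distance counts the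
difference of the weights `N + 1` times, and weights at `ℓ¹` distance `δ` can be transported at cost
`Δ ^ p δ / 2`. The factors of two cancel and `ε / C_P` remains.

Sampling (`exists_transportLE_empirical`). Mass is moved through coarser and coarser nets. At each
level only the excess mass moves, and by a variance bound and Cauchy–Schwarz its mean is at most the
root of the number of net points divided by `S`.

Whole space (`barycenters_univ_eq`). Couplings of all the marginals with one `ν` are glued along
`ν`. A tuple served from `y` pays at least its centroid cost, and strictly more if `y` is not a
centroid, so a minimiser lives on `C`. -/

namespace WassersteinBarycenter

/-! ### Transport plans between finite types -/

/-- `γ` is a nonnegative matrix with row sums `α` and column sums `β`. -/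
def IsPlan {I J : Type*} [Fintype I] [Fintype J] (γ : I → J → ℝ) (α : I → ℝ) (β : J → ℝ) : Prop :=
  (∀ i j, 0 ≤ γ i j) ∧ (∀ i, ∑ j, γ i j = α i) ∧ ∀ j, ∑ i, γ i j = β j

section Plan

variable {I J K : Type*} [Fintype I] [Fintype J] [Fintype K]

lemma IsPlan.symm {γ : I → J → ℝ} {α : I → ℝ} {β : J → ℝ} (h : IsPlan γ α β) :
    IsPlan (fun j i => γ i j) β α :=
  ⟨fun j i => h.1 i j, h.2.2, h.2.1⟩

/-- Two plans with a common marginal can be glued; the cost of the glued plan is controlled as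
soon as the costs satisfy a triangle inequality. -/
lemma IsPlan.trans {γ : I → J → ℝ} {δ : J → K → ℝ} {α : I → ℝ} {β : J → ℝ} {ζ : K → ℝ}
    (hγ : IsPlan γ α β) (hδ : IsPlan δ β ζ) {c₁ : I → J → ℝ} {c₂ : J → K → ℝ} {c₃ : I → K → ℝ}
    (hc : ∀ i j k, c₃ i k ≤ c₁ i j + c₂ j k) :
    ∃ η, IsPlan η α ζ ∧
      ∑ i, ∑ k, η i k * c₃ i k ≤ ∑ i, ∑ j, γ i j * c₁ i j + ∑ j, ∑ k, δ j k * c₂ j k := by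
  have hβ : ∀ j, 0 ≤ β j := fun j => hδ.2.1 j ▸ Finset.sum_nonneg fun k _ => hδ.1 j k
  have hγ0 : ∀ i j, β j = 0 → γ i j = 0 := fun i j hj =>
    (Finset.sum_eq_zero_iff_of_nonneg fun i _ => hγ.1 i j).1 ((hγ.2.2 j).trans hj) i
      (Finset.mem_univ i)
  have hδ0 : ∀ j k, β j = 0 → δ j k = 0 := fun j k hj =>
    (Finset.sum_eq_zero_iff_of_nonneg fun k _ => hδ.1 j k).1 ((hδ.2.1 j).trans hj) k
      (Finset.mem_univ k)
  -- The two plans are made conditionally independent given `j`. Where `β j = 0` the quotient is `0`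
  -- by convention, which is right because `γ i j` and `δ j k` vanish there.
  let θ : I → J → K → ℝ := fun i j k => γ i j * δ j k / β j
  have hθ : ∀ i j k, 0 ≤ θ i j k := fun i j k =>
    div_nonneg (mul_nonneg (hγ.1 i j) (hδ.1 j k)) (hβ j)
  have h1 : ∀ i j, ∑ k, θ i j k = γ i j := by
    intro i j
    simp only [θ]
    rw [← Finset.sum_div, ← Finset.mul_sum, hδ.2.1]
    by_cases hj : β j = 0
    · simp [hj, hγ0 i j hj]
    · field_simp
  have h2 : ∀ j k, ∑ i, θ i j k = δ j k := by
    intro j k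
    simp only [θ]
    rw [← Finset.sum_div, ← Finset.sum_mul, hγ.2.2]
    by_cases hj : β j = 0
    · simp [hj, hδ0 j k hj]
    · field_simp
  refine ⟨fun i k => ∑ j, θ i j k, ⟨fun i k => Finset.sum_nonneg fun j _ => hθ i j k,
    fun i => ?_, fun k => ?_⟩, ?_⟩
  · rw [Finset.sum_comm, ← hγ.2.1 i]
    exact Finset.sum_congr rfl fun j _ => h1 i j
  · rw [Finset.sum_comm, ← hδ.2.2 k]
    exact Finset.sum_congr rfl fun j _ => h2 j k
  · have e1 : ∑ i, ∑ j, γ i j * c₁ i j = ∑ i, ∑ k, ∑ j, θ i j k * c₁ i j := by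
      refine Finset.sum_congr rfl fun i _ => ?_
      rw [Finset.sum_comm]
      exact Finset.sum_congr rfl fun j _ => by rw [← h1 i j, Finset.sum_mul]
    have e2 : ∑ j, ∑ k, δ j k * c₂ j k = ∑ i, ∑ k, ∑ j, θ i j k * c₂ j k := by
      have : ∀ j k, δ j k * c₂ j k = ∑ i, θ i j k * c₂ j k := fun j k => by
        rw [← h2 j k, Finset.sum_mul]
      simp only [this]
      rw [Finset.sum_comm]
      simp only [Finset.sum_comm (s := (Finset.univ : Finset J)) (t := (Finset.univ : Finset I))]
      rw [Finset.sum_comm]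
    rw [e1, e2, ← Finset.sum_add_distrib]
    refine Finset.sum_le_sum fun i _ => ?_
    rw [← Finset.sum_add_distrib]
    refine Finset.sum_le_sum fun k _ => ?_
    rw [← Finset.sum_add_distrib, Finset.sum_mul]
    refine Finset.sum_le_sum fun j _ => ?_
    rw [← mul_add]
    exact mul_le_mul_of_nonneg_left (hc i j k) (hθ i j k)

lemma IsPlan.add {γ γ' : I → J → ℝ} {α α' : I → ℝ} {β β' : J → ℝ} (h : IsPlan γ α β)
    (h' : IsPlan γ' α' β') :
    IsPlan (fun i j => γ i j + γ' i j) (fun i => α i + α' i) (fun j => β j + β' j) :=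
  ⟨fun i j => add_nonneg (h.1 i j) (h'.1 i j),
    fun i => by rw [Finset.sum_add_distrib, h.2.1, h'.2.1],
    fun j => by rw [Finset.sum_add_distrib, h.2.2, h'.2.2]⟩

open Classical in
lemma isPlan_map (f : I → J) {α : I → ℝ} (hα : ∀ i, 0 ≤ α i) :
    IsPlan (fun i j => if f i = j then α i else 0) α (fun j => ∑ i, if f i = j then α i else 0) :=
  ⟨fun i j => by dsimp only; split_ifs <;> simp [hα], fun i => by simp, fun j => rfl⟩

end Plan

/-! ### Transport cost on a finite metric space -/

/-- The mass distribution `α` can be moved to `β` at the cost `b`. -/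
def TransportLE {K : Type*} [Fintype K] [PseudoMetricSpace K] (α β : K → ℝ) (b : ℝ) : Prop :=
  ∃ γ, IsPlan γ α β ∧ ∑ x, ∑ y, γ x y * dist x y ≤ b

open Classical in
/-- The image of a signed mass distribution under a map. -/
noncomputable def push {K : Type*} [Fintype K] (f : K → K) (u : K → ℝ) (y : K) : ℝ :=
  ∑ x, if f x = y then u x else 0

/-- `iterComp f l = f (l - 1) ∘ ⋯ ∘ f 0`. -/
def iterComp {K : Type*} (f : ℕ → K → K) : ℕ → K → K
  | 0 => id
  | l + 1 => f l ∘ iterComp f l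

/-- `iterComp` recurses on the last map, whereas the induction in `transportLE_tree` strips off the
first one. -/
lemma iterComp_shift {K : Type*} (f : ℕ → K → K) (l : ℕ) :
    iterComp (fun m => f (m + 1)) l ∘ f 0 = iterComp f (l + 1) := by
  induction l with
  | zero => rfl
  | succ l ih =>
    change f (l + 1) ∘ (iterComp (fun m => f (m + 1)) l ∘ f 0) = _
    rw [ih]
    rfl

section Transport

variable {K : Type*} [Fintype K]

lemma push_sub (f : K → K) (u v : K → ℝ) : push f (u - v) = push f u - push f v := by
  classical
  ext y
  simp only [push, Pi.sub_apply, ← Finset.sum_sub_distrib]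
  exact Finset.sum_congr rfl fun x _ => by split_ifs <;> simp

lemma push_push (f g : K → K) (u : K → ℝ) : push g (push f u) = push (g ∘ f) u := by
  classical
  ext y
  simp only [push, Function.comp]
  have : ∀ z, (if g z = y then ∑ x, (if f x = z then u x else 0) else 0) =
      ∑ x, if f x = z then (if g z = y then u x else 0) else 0 := by
    intro z
    split_ifs with h
    · rfl
    · simp
  simp only [this]
  rw [Finset.sum_comm]
  simp

lemma push_id (u : K → ℝ) : push id u = u := by
  classical
  ext y
  simp [push]

lemma push_nonneg (f : K → K) {u : K → ℝ} (hu : ∀ x, 0 ≤ u x) (y : K) : 0 ≤ push f u y :=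
  Finset.sum_nonneg fun x _ => by split_ifs <;> simp [hu]

variable [PseudoMetricSpace K]

lemma TransportLE.refl {α : K → ℝ} (hα : ∀ x, 0 ≤ α x) : TransportLE α α 0 := by
  classical
  refine ⟨fun x y => if x = y then α x else 0, ?_, ?_⟩
  · exact ⟨fun x y => by dsimp only; split_ifs <;> simp [hα], fun x => by simp, fun y => by simp⟩
  · simp [ite_mul]

lemma TransportLE.symm {α β : K → ℝ} {b : ℝ} (h : TransportLE α β b) : TransportLE β α b := by
  obtain ⟨γ, h1, h2⟩ := h
  refine ⟨fun y x => γ x y, h1.symm, ?_⟩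
  rw [Finset.sum_comm]
  simpa only [dist_comm] using h2

lemma TransportLE.trans {α β ζ : K → ℝ} {b c : ℝ} (h : TransportLE α β b)
    (h' : TransportLE β ζ c) : TransportLE α ζ (b + c) := by
  obtain ⟨γ, h1, h2⟩ := h
  obtain ⟨δ, h3, h4⟩ := h'
  obtain ⟨η, h5, h6⟩ := h1.trans h3 (c₁ := dist) (c₂ := dist) (c₃ := dist)
    fun x y z => dist_triangle x y z
  exact ⟨η, h5, h6.trans (add_le_add h2 h4)⟩

lemma TransportLE.add {α β α' β' : K → ℝ} {b b' : ℝ} (h : TransportLE α β b)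
    (h' : TransportLE α' β' b') : TransportLE (α + α') (β + β') (b + b') := by
  obtain ⟨γ, h1, h2⟩ := h
  obtain ⟨δ, h3, h4⟩ := h'
  refine ⟨_, h1.add h3, ?_⟩
  simpa only [add_mul, Finset.sum_add_distrib] using add_le_add h2 h4

lemma TransportLE.mono {α β : K → ℝ} {b c : ℝ} (h : TransportLE α β b) (hbc : b ≤ c) :
    TransportLE α β c :=
  ⟨h.choose, h.choose_spec.1, h.choose_spec.2.trans hbc⟩

lemma TransportLE.push {f : K → K} {r : ℝ} (hf : ∀ x, dist x (f x) ≤ r) {α : K → ℝ}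
    (hα : ∀ x, 0 ≤ α x) : TransportLE α (push f α) (r * ∑ x, α x) := by
  classical
  refine ⟨_, isPlan_map f hα, ?_⟩
  rw [Finset.mul_sum]
  refine Finset.sum_le_sum fun x _ => ?_
  simp only [ite_mul, zero_mul, Finset.sum_ite_eq, Finset.mem_univ, if_true]
  rw [mul_comm]
  exact mul_le_mul_of_nonneg_right (hf x) (hα x)

/-- Moving mass up along a tree: the cost is at most the sum, over the edges, of the length of the
edge times the excess mass below it. -/
lemma transportLE_tree (n : ℕ) (f : ℕ → K → K) (r : ℕ → ℝ) (hf : ∀ l < n, ∀ x, dist x (f l x) ≤ r l)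
    (α β : K → ℝ) (hα : ∀ x, 0 ≤ α x) (hβ : ∀ x, 0 ≤ β x)
    (h : push (iterComp f n) α = push (iterComp f n) β) :
    TransportLE α β (∑ l ∈ Finset.range n, r l * ∑ x, |push (iterComp f l) (α - β) x|) := by
  induction n generalizing f r α β with
  | zero =>
    have : α = β := by simpa [iterComp, push_id] using h
    subst this
    simpa using TransportLE.refl hα
  | succ n ih =>
    -- The common mass `m` stays where it is. Only the excesses `u` and `v` move, and their total is
    -- the `ℓ¹` norm of `α - β`.
    set u : K → ℝ := fun x => α x - min (α x) (β x)
    set v : K → ℝ := fun x => β x - min (α x) (β x)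
    set m : K → ℝ := fun x => min (α x) (β x)
    have hα' : α = m + u := by ext x; simp [m, u]
    have hβ' : β = m + v := by ext x; simp [m, v]
    have hu : ∀ x, 0 ≤ u x := fun x => sub_nonneg.2 (min_le_left _ _)
    have hv : ∀ x, 0 ≤ v x := fun x => sub_nonneg.2 (min_le_right _ _)
    have huv : u - v = α - β := by rw [hα', hβ']; abel
    have habs : ∑ x, |(α - β) x| = ∑ x, u x + ∑ x, v x := by
      rw [← Finset.sum_add_distrib]
      refine Finset.sum_congr rfl fun x _ => ?_
      simp only [Pi.sub_apply, u, v]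
      rcases le_total (α x) (β x) with hx | hx
      · rw [abs_of_nonpos (by linarith), min_eq_left hx]; ring
      · rw [abs_of_nonneg (by linarith), min_eq_right hx]; ring
    -- Both excesses are lifted by `f 0`. What remains is the same problem for the shifted maps, and
    -- the difference of its data is the image of `α - β`.
    have key := ih (fun l => f (l + 1)) (fun l => r (l + 1))
      (fun l hl x => hf (l + 1) (by omega) x) (push (f 0) u) (push (f 0) v)
      (push_nonneg _ hu) (push_nonneg _ hv) (by
        have e : push (iterComp f (n + 1)) (u - v) = 0 := by
          rw [huv, push_sub, h, sub_self]
        rw [push_sub, sub_eq_zero] at e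
        simpa only [push_push, iterComp_shift] using e)
    have step := (TransportLE.refl (α := m) fun x => le_min (hα x) (hβ x)).add
      (((TransportLE.push (hf 0 n.succ_pos) hu).trans key).trans
        (TransportLE.push (hf 0 n.succ_pos) hv).symm)
    rw [← hα', ← hβ'] at step
    refine step.mono (le_of_eq ?_)
    rw [Finset.sum_range_succ']
    simp only [← push_sub, push_push, iterComp_shift, huv]
    simp only [iterComp, push_id, habs]
    ring

end Transport

/-- `t ↦ t ^ p` is Lipschitz with constant `p D ^ (p - 1)` on `[0, D]`. -/
lemma rpow_le_rpow_add {a b c D p : ℝ} (hp : 1 ≤ p) (ha : 0 ≤ a) (haD : a ≤ D) (hb : 0 ≤ b)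
    (hc : 0 ≤ c) (h : a ≤ b + c) : a ^ p ≤ b ^ p + p * D ^ (p - 1) * c := by
  have hD : 0 ≤ D := ha.trans haD
  rcases le_or_gt a b with hab | hab
  · have := Real.rpow_le_rpow ha hab (by linarith : 0 ≤ p)
    have : 0 ≤ p * D ^ (p - 1) * c := by positivity
    linarith
  · have ha' : 0 < a := hb.trans_lt hab
    -- Bernoulli's inequality at `b / a` is the tangent line bound `b ^ p ≥ a ^ p - p a ^ (p - 1) (a
    -- - b)`.
    have h1 := one_add_mul_self_le_rpow_one_add (s := b / a - 1)
      (by have := div_nonneg hb ha; linarith) hp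
    rw [show (1 : ℝ) + (b / a - 1) = b / a by ring, Real.div_rpow hb ha] at h1
    have hap : 0 < a ^ p := Real.rpow_pos_of_pos ha' p
    have e : a ^ p = a ^ (p - 1) * a := by
      rw [Real.rpow_sub_one ha'.ne']; field_simp
    rw [le_div_iff₀ hap] at h1
    have h2 : (1 + p * (b / a - 1)) * a ^ p = a ^ p - p * a ^ (p - 1) * (a - b) := by
      rw [e]; field_simp; ring
    have h3 : p * a ^ (p - 1) * (a - b) ≤ p * D ^ (p - 1) * c := by
      have : a ^ (p - 1) ≤ D ^ (p - 1) := Real.rpow_le_rpow ha haD (by linarith)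
      have h0 : 0 ≤ a ^ (p - 1) := Real.rpow_nonneg ha _
      gcongr
      linarith
    linarith

end WassersteinBarycenter

namespace WassersteinBarycenter

/-! ### Measures on finite sets -/

/-- The measure `∑ⱼ aⱼ δⱼ`. -/
noncomputable def atomic {Y : Type*} [MeasurableSpace Y] (C : Finset Y) (a : C → ℝ) : Measure Y :=
  ∑ j : C, ENNReal.ofReal (a j) • Measure.dirac (j : Y)

section Atomic

variable {Z : Type*} [MeasurableSpace Z] [MeasurableSingletonClass Z]

lemma measure_eq_sum_of_compl_eq_zero (F : Finset Z) (ν : Measure Z) (h : ν (F : Set Z)ᶜ = 0) :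
    ν = ∑ j : F, ν {(j : Z)} • Measure.dirac (j : Z) := by
  classical
  ext B hB
  have h1 : ν B = ν (B ∩ F) := (measure_inter_conull h).symm
  have h2 : B ∩ (F : Set Z) = ((F.filter (· ∈ B) : Finset Z) : Set Z) := by
    ext; simp [and_comm]
  rw [h1, h2, ← sum_measure_singleton, Finset.sum_filter, ← Finset.sum_coe_sort]
  simp only [Measure.finsetSum_apply, Measure.smul_apply, smul_eq_mul,
    Measure.dirac_apply' _ hB]
  refine Finset.sum_congr rfl fun j _ => ?_
  by_cases hj : (j : Z) ∈ B <;> simp [hj]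

lemma lintegral_eq_sum_of_compl_eq_zero (F : Finset Z) (ν : Measure Z) (h : ν (F : Set Z)ᶜ = 0)
    (f : Z → ℝ≥0∞) : ∫⁻ z, f z ∂ν = ∑ j : F, ν {(j : Z)} * f j := by
  conv_lhs => rw [measure_eq_sum_of_compl_eq_zero F ν h]
  simp [lintegral_smul_measure]

lemma atomic_measureReal (F : Finset Z) (ν : Measure Z) [IsFiniteMeasure ν]
    (h : ν (F : Set Z)ᶜ = 0) : atomic F (fun j => ν.real {(j : Z)}) = ν := by
  conv_rhs => rw [measure_eq_sum_of_compl_eq_zero F ν h]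
  simp [atomic]

lemma atomic_compl (F : Finset Z) (a : F → ℝ) : atomic F a (F : Set Z)ᶜ = 0 := by
  simp [atomic]

lemma atomic_mem_probOn (F : Finset Z) {a : F → ℝ} (ha : ∀ j, 0 ≤ a j) (h1 : ∑ j, a j = 1) :
    atomic F a ∈ probOn (F : Set Z) := by
  refine ⟨⟨?_⟩, atomic_compl F a⟩
  simp only [atomic, Measure.finsetSum_apply, Measure.smul_apply, measure_univ, smul_eq_mul,
    mul_one]
  rw [← ENNReal.ofReal_sum_of_nonneg fun j _ => ha j, h1, ENNReal.ofReal_one]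

lemma sum_measureReal_of_mem_probOn {F : Finset Z} {ν : Measure Z} (h : ν ∈ probOn (F : Set Z)) :
    ∑ j : F, ν.real {(j : Z)} = 1 := by
  have := h.1
  rw [Finset.sum_coe_sort F fun j => ν.real {j}, sum_measureReal_singleton, Measure.real,
    (prob_compl_eq_zero_iff F.measurableSet).1 h.2, ENNReal.toReal_one]

lemma atomic_of_mem_probOn {F : Finset Z} {ν : Measure Z} (h : ν ∈ probOn (F : Set Z)) :
    atomic F (fun j => ν.real {(j : Z)}) = ν :=
  have := h.1
  atomic_measureReal F ν h.2

end Atomic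

/-! ### Transport between measures on finite sets -/

section Cost

lemma wasserstein_rpow {Y : Type*} [MetricSpace Y] [MeasurableSpace Y] {p : ℝ} (hp : 1 ≤ p) (μ ν : Measure Y) :
    wasserstein p μ ν ^ p = ⨅ π ∈ couplings μ ν, ∫⁻ z, edist z.1 z.2 ^ p ∂π := by
  rw [wasserstein, ← ENNReal.rpow_mul, one_div, inv_mul_cancel₀ (by linarith), ENNReal.rpow_one]

variable {Y : Type*} [MetricSpace Y] [MeasurableSpace Y] [BorelSpace Y]

lemma wasserstein_atomic_le {p : ℝ} (hp : 1 ≤ p) (s C : Finset Y) {γ : s → C → ℝ} {α : s → ℝ}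
    {β : C → ℝ} (h : IsPlan γ α β) :
    wasserstein p (atomic s α) (atomic C β) ^ p ≤
      ENNReal.ofReal (∑ k, ∑ j, γ k j * dist (k : Y) (j : Y) ^ p) := by
  rw [wasserstein_rpow hp]
  let π : Measure (Y × Y) :=
    ∑ k : s, ∑ j : C, ENNReal.ofReal (γ k j) • Measure.dirac ((k : Y), (j : Y))
  have hπ : π ∈ couplings (atomic s α) (atomic C β) := ⟨?_, ?_⟩
  · refine (iInf₂_le π hπ).trans (le_of_eq ?_)
    have h0 : ∀ k j, 0 ≤ γ k j * dist (k : Y) (j : Y) ^ p := fun k j =>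
      mul_nonneg (h.1 k j) (Real.rpow_nonneg dist_nonneg _)
    rw [ENNReal.ofReal_sum_of_nonneg fun k _ => Finset.sum_nonneg fun j _ => h0 k j]
    simp only [π, lintegral_finsetSum_measure, lintegral_smul_measure, lintegral_dirac]
    refine Finset.sum_congr rfl fun k _ => ?_
    rw [ENNReal.ofReal_sum_of_nonneg fun j _ => h0 k j]
    refine Finset.sum_congr rfl fun j _ => ?_
    rw [ENNReal.ofReal_mul (h.1 k j), ← ENNReal.ofReal_rpow_of_nonneg dist_nonneg (by linarith),
      edist_dist, smul_eq_mul]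
  · ext B hB
    simp only [π, atomic, Measure.fst_apply hB, Measure.finsetSum_apply, Measure.smul_apply,
      smul_eq_mul, Measure.dirac_apply' _ hB, Measure.dirac_apply' _ (measurable_fst hB)]
    refine Finset.sum_congr rfl fun k _ => ?_
    rw [← h.2.1 k, ENNReal.ofReal_sum_of_nonneg fun j _ => h.1 k j, Finset.sum_mul]
    rfl
  · ext B hB
    simp only [π, atomic, Measure.snd_apply hB, Measure.finsetSum_apply, Measure.smul_apply,
      smul_eq_mul, Measure.dirac_apply' _ hB, Measure.dirac_apply' _ (measurable_snd hB)]
    rw [Finset.sum_comm]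
    refine Finset.sum_congr rfl fun j _ => ?_
    rw [← h.2.2 j, ENNReal.ofReal_sum_of_nonneg fun k _ => h.1 k j, Finset.sum_mul]
    rfl

/-- Converse of `wasserstein_atomic_le`: a coupling of measures on finite sets puts no mass outside
`s ×ˢ C`, so its point masses carry its marginals and its whole cost. -/
lemma exists_isPlan_of_coupling {p : ℝ} (hp : 1 ≤ p) {s C : Finset Y} {μ ν : Measure Y}
    (hμ : μ ∈ probOn (s : Set Y)) (hν : ν ∈ probOn (C : Set Y)) {π : Measure (Y × Y)}
    (hπ : π ∈ couplings μ ν) :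
    ∃ γ : s → C → ℝ, IsPlan γ (fun k => μ.real {(k : Y)}) (fun j => ν.real {(j : Y)}) ∧
      ∫⁻ z, edist z.1 z.2 ^ p ∂π = ENNReal.ofReal (∑ k, ∑ j, γ k j * dist (k : Y) (j : Y) ^ p) := by
  obtain ⟨h1, h2⟩ := hπ
  have := hμ.1
  have : IsProbabilityMeasure π := ⟨by
    rw [← Measure.fst_univ, h1, measure_univ]⟩
  have m1 : ∀ B, MeasurableSet B → π (Prod.fst ⁻¹' B) = μ B := fun B hB => by
    rw [← h1, Measure.fst_apply hB]
  have m2 : ∀ B, MeasurableSet B → π (Prod.snd ⁻¹' B) = ν B := fun B hB => by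
    rw [← h2, Measure.snd_apply hB]
  have c1 : π (Prod.fst ⁻¹' (s : Set Y)ᶜ) = 0 := (m1 _ s.measurableSet.compl).trans hμ.2
  have c2 : π (Prod.snd ⁻¹' (C : Set Y)ᶜ) = 0 := (m2 _ C.measurableSet.compl).trans hν.2
  have hc : π ((s ×ˢ C : Finset (Y × Y)) : Set (Y × Y))ᶜ = 0 := by
    refine measure_mono_null (fun z hz => ?_) (measure_union_null c1 c2)
    simp only [Finset.coe_product, Set.mem_compl_iff, Set.mem_prod, not_and_or] at hz
    exact hz
  refine ⟨fun k j => π.real {((k : Y), (j : Y))}, ⟨fun k j => measureReal_nonneg, fun k => ?_,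
    fun j => ?_⟩, ?_⟩
  · have e : π.real (Prod.fst ⁻¹' {(k : Y)}) = μ.real {(k : Y)} := by
      rw [Measure.real, m1 _ (measurableSet_singleton _), Measure.real]
    refine Eq.trans ?_ e
    have : π.real (Prod.fst ⁻¹' {(k : Y)}) =
        π.real (({(k : Y)} ×ˢ C : Finset (Y × Y)) : Set (Y × Y)) := by
      rw [Measure.real, Measure.real]
      congr 1
      rw [← measure_inter_conull (t := Prod.snd ⁻¹' (C : Set Y)) c2]
      congr 1
      ext z
      simp only [Finset.coe_product, Finset.coe_singleton, Set.mem_inter_iff, Set.mem_preimage,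
        Set.mem_prod, Set.mem_singleton_iff]
    rw [this, ← sum_measureReal_singleton, Finset.sum_product, Finset.sum_singleton]
    exact Finset.sum_coe_sort C fun j => π.real {((k : Y), j)}
  · have e : π.real (Prod.snd ⁻¹' {(j : Y)}) = ν.real {(j : Y)} := by
      rw [Measure.real, m2 _ (measurableSet_singleton _), Measure.real]
    refine Eq.trans ?_ e
    have : π.real (Prod.snd ⁻¹' {(j : Y)}) =
        π.real ((s ×ˢ {(j : Y)} : Finset (Y × Y)) : Set (Y × Y)) := by
      rw [Measure.real, Measure.real]
      congr 1
      rw [← measure_inter_conull (t := Prod.fst ⁻¹' (s : Set Y)) c1]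
      congr 1
      ext z
      simp only [Finset.coe_product, Finset.coe_singleton, Set.mem_inter_iff, Set.mem_preimage,
        Set.mem_prod, Set.mem_singleton_iff, and_comm]
    rw [this, ← sum_measureReal_singleton, Finset.sum_product]
    simp only [Finset.sum_singleton]
    exact Finset.sum_coe_sort s fun k => π.real {(k, (j : Y))}
  · rw [lintegral_eq_sum_of_compl_eq_zero _ π hc,
      Finset.sum_coe_sort (s ×ˢ C) fun z => π {z} * edist z.1 z.2 ^ p, Finset.sum_product,
      ← Finset.sum_coe_sort]
    have h0 : ∀ (k : s) (j : C), 0 ≤ π.real {((k : Y), (j : Y))} * dist (k : Y) (j : Y) ^ p :=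
      fun k j => mul_nonneg measureReal_nonneg (Real.rpow_nonneg dist_nonneg _)
    rw [ENNReal.ofReal_sum_of_nonneg fun k _ => Finset.sum_nonneg fun j _ => h0 k j]
    refine Finset.sum_congr rfl fun k _ => ?_
    rw [ENNReal.ofReal_sum_of_nonneg fun j _ => h0 k j, ← Finset.sum_coe_sort]
    refine Finset.sum_congr rfl fun j _ => ?_
    rw [ENNReal.ofReal_mul measureReal_nonneg,
      ← ENNReal.ofReal_rpow_of_nonneg dist_nonneg (by linarith), edist_dist, ofReal_measureReal]

/-- The transport cost is controlled by the total variation. -/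
lemma wasserstein_atomic_le_sum_abs {p : ℝ} (hp : 1 ≤ p) (C : Finset Y) {a b : C → ℝ}
    (ha : ∀ j, 0 ≤ a j) (hb : ∀ j, 0 ≤ b j) (hab : ∑ j, a j = ∑ j, b j) {D : ℝ}
    (hD : ∀ x ∈ C, ∀ y ∈ C, dist x y ≤ D) :
    wasserstein p (atomic C a) (atomic C b) ^ p ≤
      ENNReal.ofReal (D ^ p * ((∑ j, |a j - b j|) / 2)) := by
  classical
  -- The common mass stays put for free. The excesses have the same total `t`, half the `ℓ¹`
  -- distance, and are coupled by their normalised product; if `t = 0` both vanish and the division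
  -- by zero is harmless.
  set u : C → ℝ := fun x => a x - min (a x) (b x)
  set v : C → ℝ := fun x => b x - min (a x) (b x)
  have hu : ∀ x, 0 ≤ u x := fun x => sub_nonneg.2 (min_le_left _ _)
  have hv : ∀ x, 0 ≤ v x := fun x => sub_nonneg.2 (min_le_right _ _)
  have huv : ∑ x, u x = ∑ x, v x := by
    simp only [u, v, Finset.sum_sub_distrib, hab]
  have habs : ∑ x, |a x - b x| = ∑ x, u x + ∑ x, v x := by
    rw [← Finset.sum_add_distrib]
    refine Finset.sum_congr rfl fun x _ => ?_
    simp only [u, v]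
    rcases le_total (a x) (b x) with hx | hx
    · rw [abs_of_nonpos (by linarith), min_eq_left hx]; ring
    · rw [abs_of_nonneg (by linarith), min_eq_right hx]; ring
  set t := ∑ x, u x
  have ht : 0 ≤ t := Finset.sum_nonneg fun x _ => hu x
  have hu0 : t = 0 → ∀ x, u x = 0 := fun h x =>
    (Finset.sum_eq_zero_iff_of_nonneg fun x _ => hu x).1 h x (Finset.mem_univ x)
  have hv0 : t = 0 → ∀ x, v x = 0 := fun h x =>
    (Finset.sum_eq_zero_iff_of_nonneg fun x _ => hv x).1 (huv ▸ h) x (Finset.mem_univ x)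
  have p1 : IsPlan (fun x y : C => if x = y then min (a x) (b x) else 0)
      (fun x => min (a x) (b x)) (fun x => min (a x) (b x)) :=
    ⟨fun x y => by dsimp only; split_ifs <;> simp [ha, hb], fun x => by simp, fun y => by simp⟩
  have p2 : IsPlan (fun x y : C => u x * v y / t) u v := by
    refine ⟨fun x y => div_nonneg (mul_nonneg (hu x) (hv y)) ht, fun x => ?_, fun y => ?_⟩
    · rw [← Finset.sum_div, ← Finset.mul_sum, ← huv]
      by_cases h : t = 0
      · simp [h, hu0 h]
      · field_simp
    · rw [← Finset.sum_div, ← Finset.sum_mul]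
      by_cases h : t = 0
      · simp [h, hv0 h]
      · change t * v y / t = v y
        field_simp
  have p3 := p1.add p2
  have e1 : (fun x => min (a x) (b x) + u x) = a := by ext x; simp [u]
  have e2 : (fun x => min (a x) (b x) + v x) = b := by ext x; simp [v]
  rw [e1, e2] at p3
  refine (wasserstein_atomic_le hp C C p3).trans (ENNReal.ofReal_le_ofReal ?_)
  have e3 : ∑ x : C, ∑ y : C, u x * v y / t = t := Finset.sum_congr rfl fun x _ => p2.2.1 x
  rw [habs, ← huv, add_self_div_two]
  conv_rhs => rw [← e3, Finset.mul_sum]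
  refine Finset.sum_le_sum fun x _ => ?_
  rw [Finset.mul_sum]
  refine Finset.sum_le_sum fun y _ => ?_
  rw [add_mul, mul_comm (D ^ p)]
  have : (if x = y then min (a x) (b x) else 0) * dist (x : Y) (y : Y) ^ p = 0 := by
    split_ifs with h
    · rw [h, dist_self, Real.zero_rpow (by linarith), mul_zero]
    · rw [zero_mul]
  rw [this, zero_add]
  exact mul_le_mul_of_nonneg_left
    (Real.rpow_le_rpow dist_nonneg (hD _ x.2 _ y.2) (by linarith)) (p2.1 x y)

end Cost

end WassersteinBarycenter

namespace WassersteinBarycenter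

/-! ### The polytope of the linear program -/

section Polytope

variable {Y : Type*} [MetricSpace Y] [MeasurableSpace Y] [BorelSpace Y] {N : ℕ} {p : ℝ}
  {C : Finset Y} {s : Fin N → Finset Y} {m : Fin N → Measure Y}

lemma mem_lpFeasible_iff {z : LPVar C s} : z ∈ lpFeasible C s m ↔
    ∀ i, IsPlan (fun (k : s i) (j : C) => z.1 i j k) (fun k => (m i).real {(k : Y)}) z.2 :=
  ⟨fun h i => ⟨fun k j => h.2.2 i j k, h.2.1 i, h.1 i⟩,
    fun h => ⟨fun i => (h i).2.2, fun i => (h i).2.1, fun i j k => (h i).1 k j⟩⟩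

lemma convex_lpFeasible : Convex ℝ (lpFeasible C s m) := by
  intro z hz w hw t u ht hu htu
  refine ⟨fun i j => ?_, fun i k => ?_, fun i j k => ?_⟩
  · simp only [Prod.fst_add, Prod.smul_fst, Pi.add_apply, Pi.smul_apply, smul_eq_mul,
      Prod.snd_add, Prod.smul_snd, Finset.sum_add_distrib, ← Finset.mul_sum, hz.1, hw.1]
  · simp only [Prod.fst_add, Prod.smul_fst, Pi.add_apply, Pi.smul_apply, smul_eq_mul,
      Finset.sum_add_distrib, ← Finset.mul_sum, hz.2.1, hw.2.1, ← add_mul, htu, one_mul]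
  · exact add_nonneg (mul_nonneg ht (hz.2.2 i j k)) (mul_nonneg hu (hw.2.2 i j k))

lemma isClosed_lpFeasible : IsClosed (lpFeasible C s m) := by
  simp only [lpFeasible, Set.ofPred_and, Set.ofPred_forall]
  refine IsClosed.inter ?_ (IsClosed.inter ?_ ?_)
  · exact isClosed_iInter fun i => isClosed_iInter fun j =>
      isClosed_eq (by fun_prop) (by fun_prop)
  · exact isClosed_iInter fun i => isClosed_iInter fun j =>
      isClosed_eq (by fun_prop) (by fun_prop)
  · exact isClosed_iInter fun i => isClosed_iInter fun j => isClosed_iInter fun k =>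
      isClosed_le (by fun_prop) (by fun_prop)

lemma snd_nonneg_of_mem_lpFeasible (hN : 1 ≤ N) {z : LPVar C s} (hz : z ∈ lpFeasible C s m)
    (j : C) : 0 ≤ z.2 j := by
  rw [← hz.1 ⟨0, hN⟩ j]
  exact Finset.sum_nonneg fun k _ => hz.2.2 _ j k

lemma sum_snd_of_mem_lpFeasible (hN : 1 ≤ N) (hm : ∀ i, m i ∈ probOn (s i : Set Y))
    {z : LPVar C s} (hz : z ∈ lpFeasible C s m) : ∑ j, z.2 j = 1 := by
  have h : ∀ j, z.2 j = ∑ k, z.1 ⟨0, hN⟩ j k := fun j => (hz.1 _ j).symm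
  simp only [h]
  rw [Finset.sum_comm]
  simp only [hz.2.1]
  exact sum_measureReal_of_mem_probOn (hm _)

lemma isCompact_lpFeasible (hN : 1 ≤ N) (hm : ∀ i, m i ∈ probOn (s i : Set Y)) :
    IsCompact (lpFeasible C s m) := by
  refine IsCompact.of_isClosed_subset (isCompact_Icc (a := (0 : LPVar C s)) (b := 1))
    isClosed_lpFeasible fun z hz => ?_
  -- A weight is at most the total mass `1`, and an entry of a plan is at most the weight that it
  -- sums to.
  have ha : ∀ j, z.2 j ≤ 1 := fun j => by
    rw [← sum_snd_of_mem_lpFeasible hN hm hz]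
    exact Finset.single_le_sum (f := z.2)
      (fun j _ => snd_nonneg_of_mem_lpFeasible hN hz j) (Finset.mem_univ j)
  refine ⟨⟨fun i j k => hz.2.2 i j k, fun j => snd_nonneg_of_mem_lpFeasible hN hz j⟩,
    ⟨fun i j k => ?_, ha⟩⟩
  refine le_trans ?_ (ha j)
  rw [← hz.1 i j]
  exact Finset.single_le_sum (f := fun k => z.1 i j k) (fun k _ => hz.2.2 i j k)
    (Finset.mem_univ k)

lemma continuous_lpCost : Continuous (lpCost p C s) := by
  unfold lpCost
  fun_prop

lemma lpCost_combo (z w : LPVar C s) (t u : ℝ) :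
    lpCost p C s (t • z + u • w) = t * lpCost p C s z + u * lpCost p C s w := by
  simp only [lpCost, Prod.fst_add, Prod.smul_fst, Pi.add_apply, Pi.smul_apply, smul_eq_mul, add_mul,
    Finset.sum_add_distrib, mul_assoc, ← Finset.mul_sum]
  ring

lemma lpCost_nonneg {z : LPVar C s} (hz : z ∈ lpFeasible C s m) : 0 ≤ lpCost p C s z :=
  mul_nonneg (by positivity) (Finset.sum_nonneg fun i _ => Finset.sum_nonneg fun j _ =>
    Finset.sum_nonneg fun k _ => mul_nonneg (hz.2.2 i j k) (Real.rpow_nonneg dist_nonneg _))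

lemma lpFeasible_nonempty (hm : ∀ i, m i ∈ probOn (s i : Set Y)) (hC : C.Nonempty) :
    (lpFeasible C s m).Nonempty := by
  classical
  obtain ⟨c, hc⟩ := hC
  refine ⟨(fun i j k => if j = ⟨c, hc⟩ then (m i).real {(k : Y)} else 0,
    fun j => if j = ⟨c, hc⟩ then 1 else 0), fun i j => ?_, fun i k => ?_, fun i j k => ?_⟩
  · by_cases h : j = ⟨c, hc⟩
    · simpa [h] using sum_measureReal_of_mem_probOn (hm i)
    · simp [h]
  · simp
  · dsimp only
    split_ifs <;> simp

lemma lpMinimisers_nonempty (hN : 1 ≤ N) (hm : ∀ i, m i ∈ probOn (s i : Set Y))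
    (hC : C.Nonempty) : (lpMinimisers p C s m).Nonempty := by
  obtain ⟨z, hz, h⟩ := (isCompact_lpFeasible hN hm).exists_isMinOn (lpFeasible_nonempty hm hC)
    (continuous_lpCost (p := p)).continuousOn
  exact ⟨z, hz, fun w hw => h hw⟩

lemma lpCost_eq_lpValue {z : LPVar C s} (hz : z ∈ lpMinimisers p C s m) :
    lpCost p C s z = lpValue p C s m := by
  refine le_antisymm ?_ ?_
  · refine le_csInf ⟨_, z, hz.1, rfl⟩ ?_
    rintro _ ⟨w, hw, rfl⟩
    exact hz.2 w hw
  · refine csInf_le ⟨0, ?_⟩ ⟨z, hz.1, rfl⟩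
    rintro _ ⟨w, hw, rfl⟩
    exact lpCost_nonneg hw

lemma convex_lpMinimisers : Convex ℝ (lpMinimisers p C s m) := by
  intro z hz w hw t u ht hu htu
  refine ⟨convex_lpFeasible hz.1 hw.1 ht hu htu, fun y hy => ?_⟩
  rw [lpCost_combo]
  have h1 := mul_le_mul_of_nonneg_left (hz.2 y hy) ht
  have h2 := mul_le_mul_of_nonneg_left (hw.2 y hy) hu
  calc _ ≤ t * lpCost p C s y + u * lpCost p C s y := add_le_add h1 h2
    _ = lpCost p C s y := by rw [← add_mul, htu, one_mul]

lemma isCompact_lpMinimisers (hN : 1 ≤ N) (hm : ∀ i, m i ∈ probOn (s i : Set Y)) :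
    IsCompact (lpMinimisers p C s m) := by
  refine IsCompact.of_isClosed_subset (isCompact_lpFeasible hN hm) ?_ fun z hz => hz.1
  simp only [lpMinimisers, Set.ofPred_and, Set.ofPred_forall]
  exact isClosed_lpFeasible.inter (isClosed_iInter fun w => isClosed_iInter fun _ =>
    isClosed_le continuous_lpCost continuous_const)

/-- A function on a finite type is dominated by a positive one up to scaling. -/
lemma exists_pos_mul_le {T : Type*} [Finite T] {g h : T → ℝ} (hh : ∀ x, 0 ≤ h x)
    (hg : ∀ x, h x = 0 → g x = 0) : ∃ ε > 0, ∀ x, ε * g x ≤ h x := by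
  have H : ∀ x, ∀ᶠ ε in nhdsWithin (0 : ℝ) (Set.Ioi 0), ε * g x ≤ h x := by
    intro x
    rcases (hh x).eq_or_lt with h0 | h0
    · simp [hg x h0.symm, ← h0]
    · have ht : Filter.Tendsto (fun ε : ℝ => ε * g x) (nhdsWithin 0 (Set.Ioi 0)) (nhds 0) := by
        have : Filter.Tendsto (fun ε : ℝ => ε * g x) (nhds 0) (nhds (0 * g x)) :=
          (continuous_mul_const (g x)).tendsto 0
        rw [zero_mul] at this
        exact this.mono_left nhdsWithin_le_nhds
      exact (ht.eventually (gt_mem_nhds h0)).mono fun ε hε => le_of_lt hε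
  obtain ⟨ε, h1, h2⟩ := ((Filter.eventually_all.2 H).and self_mem_nhdsWithin).exists
  exact ⟨ε, h2, h1⟩

/-- Moving away from `w` along the line through `w` and `z` keeps `z` feasible for a short time, if
`w` vanishes where `z` does. -/
lemma add_smul_sub_mem_lpFeasible {z w : LPVar C s} (hz : z ∈ lpFeasible C s m)
    (hw : w ∈ lpFeasible C s m) {ε : ℝ}
    (h : ∀ i j k, ε * (w.1 i j k - z.1 i j k) ≤ z.1 i j k) :
    z + ε • (z - w) ∈ lpFeasible C s m := by
  refine ⟨fun i j => ?_, fun i k => ?_, fun i j k => ?_⟩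
  · simp only [Prod.fst_add, Prod.smul_fst, Pi.add_apply, Pi.smul_apply, smul_eq_mul, Prod.fst_sub,
      Prod.snd_sub, Pi.sub_apply, Prod.snd_add, Prod.smul_snd, Finset.sum_add_distrib,
      ← Finset.mul_sum, Finset.sum_sub_distrib, hz.1, hw.1]
  · simp only [Prod.fst_add, Prod.smul_fst, Pi.add_apply, Pi.smul_apply, smul_eq_mul, Prod.fst_sub,
      Pi.sub_apply, Finset.sum_add_distrib, ← Finset.mul_sum, Finset.sum_sub_distrib, hz.2.1,
      hw.2.1, sub_self, mul_zero, add_zero]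
  · have := h i j k
    simp only [Prod.fst_add, Prod.smul_fst, Pi.add_apply, Pi.smul_apply, smul_eq_mul, Prod.fst_sub,
      Pi.sub_apply]
    linarith

/-- An extreme point is determined by its set of zero entries, and there are finitely many such
sets: if `w` has the same zeros as `z`, then `z ± ε (z - w)` are feasible for small `ε`, which
forces `z = w`. -/
lemma finite_extremePoints_lpFeasible :
    ((lpFeasible C s m).extremePoints ℝ).Finite := by
  let T := Σ i : Fin N, C × s i
  let σ : LPVar C s → Set T := fun z => {x | z.1 x.1 x.2.1 x.2.2 = 0}
  refine Set.Finite.of_finite_image (f := σ) (Set.toFinite _) ?_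
  intro z hz w hw hzw
  obtain ⟨hz, hext⟩ := mem_extremePoints.1 hz
  have hw := extremePoints_subset hw
  have h0 : ∀ i j k, z.1 i j k = 0 ↔ w.1 i j k = 0 := fun i j k =>
    Set.ext_iff.1 hzw (⟨i, j, k⟩ : T)
  obtain ⟨ε, hε, h⟩ := exists_pos_mul_le (T := T)
    (g := fun x => |z.1 x.1 x.2.1 x.2.2 - w.1 x.1 x.2.1 x.2.2|)
    (h := fun x => z.1 x.1 x.2.1 x.2.2) (fun x => hz.2.2 _ _ _) (fun x hx => by
      simp only [hx, (h0 _ _ _).1 hx, sub_self, abs_zero])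
  have h1 : z + ε • (z - w) ∈ lpFeasible C s m := add_smul_sub_mem_lpFeasible hz hw
    fun i j k => (mul_le_mul_of_nonneg_left ((le_abs_self _).trans_eq (abs_sub_comm _ _))
      hε.le).trans (h ⟨i, j, k⟩)
  have h2 : z + (-ε) • (z - w) ∈ lpFeasible C s m := add_smul_sub_mem_lpFeasible hz hw
    fun i j k => by
      refine le_trans ?_ (h ⟨i, j, k⟩)
      have := mul_le_mul_of_nonneg_left (le_abs_self (z.1 i j k - w.1 i j k)) hε.le
      dsimp only
      linarith
  have h3 := hext _ h1 _ h2 ⟨1 / 2, 1 / 2, by norm_num, by norm_num, by norm_num, by module⟩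
  have h4 : ε • (z - w) = 0 := by simpa using h3.1
  exact sub_eq_zero.1 ((smul_eq_zero.1 h4).resolve_left hε.ne')

/-- Krein–Milman yields the closed convex hull; the hull of finitely many points is already closed.
-/
lemma convexHull_extremePoints_lpFeasible (hN : 1 ≤ N)
    (hm : ∀ i, m i ∈ probOn (s i : Set Y)) :
    convexHull ℝ ((lpFeasible C s m).extremePoints ℝ) = lpFeasible C s m := by
  rw [← ((finite_extremePoints_lpFeasible).isClosed_convexHull ℝ).closure_eq]
  exact closure_convexHull_extremePoints (isCompact_lpFeasible hN hm) convex_lpFeasible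

/-! ### Sharpness of the minimum -/

lemma lpDist_nonneg (z w : LPVar C s) : 0 ≤ lpDist z w := by
  unfold lpDist
  positivity

lemma lpDist_self (z : LPVar C s) : lpDist z z = 0 := by
  simp [lpDist]

lemma eq_of_lpDist_eq_zero {z w : LPVar C s} (h : lpDist z w = 0) : z = w := by
  unfold lpDist at h
  have h1 : 0 ≤ ∑ i, ∑ j, ∑ k, |z.1 i j k - w.1 i j k| := by positivity
  have h2 : 0 ≤ ∑ j, |z.2 j - w.2 j| := by positivity
  have h3 : ∑ i, ∑ j, ∑ k, |z.1 i j k - w.1 i j k| = 0 := by linarith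
  have h4 : ∑ j, |z.2 j - w.2 j| = 0 := by linarith
  refine Prod.ext (funext fun i => funext fun j => funext fun k => ?_) (funext fun j => ?_)
  · rw [Finset.sum_eq_zero_iff_of_nonneg (fun _ _ => by positivity)] at h3
    have h3 := h3 i (Finset.mem_univ i)
    rw [Finset.sum_eq_zero_iff_of_nonneg (fun _ _ => by positivity)] at h3
    have h3 := h3 j (Finset.mem_univ j)
    rw [Finset.sum_eq_zero_iff_of_nonneg (fun _ _ => by positivity)] at h3
    exact sub_eq_zero.1 (abs_eq_zero.1 (h3 k (Finset.mem_univ k)))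
  · rw [Finset.sum_eq_zero_iff_of_nonneg (fun _ _ => by positivity)] at h4
    exact sub_eq_zero.1 (abs_eq_zero.1 (h4 j (Finset.mem_univ j)))

lemma continuous_lpDist (z : LPVar C s) : Continuous (lpDist z) := by
  unfold lpDist
  fun_prop

lemma lpDist_combo_le (z w x y : LPVar C s) {t u : ℝ} (ht : 0 ≤ t) (hu : 0 ≤ u) :
    lpDist (t • z + u • w) (t • x + u • y) ≤ t * lpDist z x + u * lpDist w y := by
  have key : ∀ a b c d : ℝ, |t * a + u * b - (t * c + u * d)| ≤ t * |a - c| + u * |b - d| := by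
    intro a b c d
    calc |t * a + u * b - (t * c + u * d)| = |t * (a - c) + u * (b - d)| := by congr 1; ring
      _ ≤ |t * (a - c)| + |u * (b - d)| := abs_add_le _ _
      _ = _ := by rw [abs_mul, abs_mul, abs_of_nonneg ht, abs_of_nonneg hu]
  calc lpDist (t • z + u • w) (t • x + u • y)
      ≤ ∑ i, ∑ j, ∑ k, (t * |z.1 i j k - x.1 i j k| + u * |w.1 i j k - y.1 i j k|) +
        ∑ j, (t * |z.2 j - x.2 j| + u * |w.2 j - y.2 j|) := by
        refine add_le_add (Finset.sum_le_sum fun i _ => Finset.sum_le_sum fun j _ =>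
          Finset.sum_le_sum fun k _ => key _ _ _ _) (Finset.sum_le_sum fun j _ => key _ _ _ _)
    _ = _ := by
        simp only [lpDist, Finset.sum_add_distrib, ← Finset.mul_sum]
        ring

lemma exists_lpDist_eq_lpDistTo (hN : 1 ≤ N) (hm : ∀ i, m i ∈ probOn (s i : Set Y))
    (hC : C.Nonempty) (z : LPVar C s) :
    ∃ w ∈ lpMinimisers p C s m, lpDist z w = lpDistTo z (lpMinimisers p C s m) := by
  obtain ⟨w, hw, h⟩ := (isCompact_lpMinimisers hN hm).exists_isMinOn
    (lpMinimisers_nonempty (p := p) hN hm hC) (continuous_lpDist z).continuousOn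
  refine ⟨w, hw, le_antisymm (le_csInf ⟨_, w, hw, rfl⟩ ?_) (csInf_le ⟨0, ?_⟩ ⟨w, hw, rfl⟩)⟩
  · rintro _ ⟨y, hy, rfl⟩
    exact h hy
  · rintro _ ⟨y, hy, rfl⟩
    exact lpDist_nonneg z y

/-- The least slope of the objective at the non-optimal vertices. -/
noncomputable def lpSlope (p : ℝ) (C : Finset Y) (s : Fin N → Finset Y) (m : Fin N → Measure Y) :
    ℝ :=
  sInf ((fun v => (lpCost p C s v - lpValue p C s m) / lpDistTo v (lpMinimisers p C s m)) ''
      lpNonoptVertices p C s m)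

lemma lpDistTo_pos (hN : 1 ≤ N) (hm : ∀ i, m i ∈ probOn (s i : Set Y)) (hC : C.Nonempty)
    {z : LPVar C s} (hz : z ∉ lpMinimisers p C s m) : 0 < lpDistTo z (lpMinimisers p C s m) := by
  obtain ⟨w, hw, h⟩ := exists_lpDist_eq_lpDistTo (p := p) hN hm hC z
  rw [← h]
  refine (lpDist_nonneg z w).lt_of_ne fun h0 => hz ?_
  rwa [eq_of_lpDist_eq_zero h0.symm]

lemma finite_lpNonoptVertices : (lpNonoptVertices p C s m).Finite :=
  (finite_extremePoints_lpFeasible).subset Set.sdiff_subset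

lemma lpValue_le (hN : 1 ≤ N) (hm : ∀ i, m i ∈ probOn (s i : Set Y)) (hC : C.Nonempty)
    {z : LPVar C s} (hz : z ∈ lpFeasible C s m) : lpValue p C s m ≤ lpCost p C s z := by
  obtain ⟨w, hw⟩ := lpMinimisers_nonempty (p := p) hN hm hC
  rw [← lpCost_eq_lpValue hw]
  exact hw.2 z hz

/-- The infimum over finitely many vertices is attained, and at a non-optimal vertex both the gap
and the distance are positive. This is where `C_P > 0` comes from. -/
lemma lpSlope_pos (hN : 1 ≤ N) (hm : ∀ i, m i ∈ probOn (s i : Set Y)) (hC : C.Nonempty)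
    (h : (lpNonoptVertices p C s m).Nonempty) : 0 < lpSlope p C s m := by
  obtain ⟨v, hv, hv'⟩ := (h.image _).csInf_mem ((finite_lpNonoptVertices).image
    fun v => (lpCost p C s v - lpValue p C s m) / lpDistTo v (lpMinimisers p C s m))
  rw [lpSlope, ← hv']
  refine div_pos (sub_pos.2 ?_) (lpDistTo_pos hN hm hC hv.2)
  obtain ⟨w, hw⟩ := lpMinimisers_nonempty (p := p) hN hm hC
  have hvf := extremePoints_subset hv.1
  refine (lpValue_le hN hm hC hvf).lt_of_ne fun h0 => hv.2 ⟨hvf, fun y hy => ?_⟩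
  rw [← h0]
  exact lpValue_le hN hm hC hy

/-- The objective grows at least linearly with the distance to the set of minimisers. -/
lemma exists_lpSlope_mul_lpDist_le (hN : 1 ≤ N) (hm : ∀ i, m i ∈ probOn (s i : Set Y))
    (hC : C.Nonempty) {z : LPVar C s} (hz : z ∈ lpFeasible C s m) :
    ∃ y ∈ lpMinimisers p C s m, lpSlope p C s m * lpDist z y ≤ lpCost p C s z - lpValue p C s m := by
  rw [← convexHull_extremePoints_lpFeasible hN hm] at hz
  -- Without non-optimal vertices the slope is `sInf ∅ = 0`, and the claim stays true.
  have hslope : 0 ≤ lpSlope p C s m := by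
    rcases (lpNonoptVertices p C s m).eq_empty_or_nonempty with h | h
    · simp [lpSlope, h]
    · exact (lpSlope_pos hN hm hC h).le
  -- The property is preserved by convex combinations, since the distance is jointly convex and the
  -- minimisers form a convex set. It remains to check the vertices.
  refine convexHull_min (t := {z | ∃ y ∈ lpMinimisers p C s m,
    lpSlope p C s m * lpDist z y ≤ lpCost p C s z - lpValue p C s m}) ?_ ?_ hz
  · intro v hv
    by_cases hvM : v ∈ lpMinimisers p C s m
    · exact ⟨v, hvM, by rw [lpDist_self, lpCost_eq_lpValue hvM]; simp⟩
    · obtain ⟨w, hw, h⟩ := exists_lpDist_eq_lpDistTo (p := p) hN hm hC v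
      refine ⟨w, hw, ?_⟩
      rw [h, ← le_div_iff₀ (lpDistTo_pos hN hm hC hvM)]
      exact csInf_le ((finite_lpNonoptVertices).image _).bddBelow ⟨v, ⟨hv, hvM⟩, rfl⟩
  · rintro z ⟨x, hx, hzx⟩ w ⟨y, hy, hwy⟩ t u ht hu htu
    refine ⟨t • x + u • y, convex_lpMinimisers hx hy ht hu htu, ?_⟩
    rw [lpCost_combo]
    have h1 := mul_le_mul_of_nonneg_left (lpDist_combo_le z w x y ht hu) hslope
    have h2 := mul_le_mul_of_nonneg_left hzx ht
    have h3 := mul_le_mul_of_nonneg_left hwy hu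
    have h4 : lpValue p C s m = t * lpValue p C s m + u * lpValue p C s m := by
      rw [← add_mul, htu, one_mul]
    calc _ ≤ _ := h1
      _ = t * (lpSlope p C s m * lpDist z x) + u * (lpSlope p C s m * lpDist w y) := by ring
      _ ≤ _ := add_le_add h2 h3
      _ = _ := by linear_combination h4

lemma lpFeasible_subset_lpMinimisers (hN : 1 ≤ N) (hm : ∀ i, m i ∈ probOn (s i : Set Y))
    (h : lpNonoptVertices p C s m = ∅) : lpFeasible C s m ⊆ lpMinimisers p C s m := by
  rw [← convexHull_extremePoints_lpFeasible hN hm]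
  exact convexHull_min (Set.sdiff_eq_empty.1 h) convex_lpMinimisers

/-- The distance of two points dominates the distance of their weights on `C`, with the factor
`N + 1`. -/
lemma mul_sum_abs_le_lpDist {z w : LPVar C s} (hz : z ∈ lpFeasible C s m)
    (hw : w ∈ lpFeasible C s m) : ((N : ℝ) + 1) * ∑ j, |z.2 j - w.2 j| ≤ lpDist z w := by
  -- Each of the `N` plans has the weights as its sums over `k`, so each contributes at least the
  -- difference of the weights; the last block contributes it once more.
  have h : ∀ i : Fin N, ∑ j, |z.2 j - w.2 j| ≤ ∑ j, ∑ k, |z.1 i j k - w.1 i j k| := fun i =>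
    Finset.sum_le_sum fun j _ => by
      rw [← hz.1 i j, ← hw.1 i j, ← Finset.sum_sub_distrib]
      exact Finset.abs_sum_le_sum_abs _ _
  have := Finset.sum_le_sum fun i (_ : i ∈ Finset.univ) => h i
  rw [Finset.sum_const, Finset.card_univ, Fintype.card_fin, nsmul_eq_mul] at this
  rw [add_mul, one_mul]
  exact add_le_add this le_rfl

end Polytope

end WassersteinBarycenter

namespace WassersteinBarycenter

/-! ### Gluing the couplings with a common marginal -/

/-- The marginals of a product of probability vectors. -/
lemma sum_prod_mul_eq {R ι : Type*} [CommSemiring R] [Fintype ι] [DecidableEq ι] {T : ι → Type*}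
    [∀ i, Fintype (T i)] (f : ∀ i, T i → R) (hf : ∀ i, ∑ k, f i k = 1) (i₀ : ι) (G : T i₀ → R) :
    ∑ κ : ∀ i, T i, (∏ i, f i (κ i)) * G (κ i₀) = ∑ k, f i₀ k * G k := by
  classical
  -- Absorbing `G` into the factor of index `i₀` leaves a sum of pure products, which factorises.
  have h : ∀ κ : ∀ i, T i, (∏ i, f i (κ i)) * G (κ i₀) =
      ∏ i, (f i (κ i) * if h : i = i₀ then G (h ▸ κ i) else 1) := by
    intro κ
    rw [Finset.prod_mul_distrib]
    congr 1
    rw [Finset.prod_eq_single i₀]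
    · simp
    · intro i _ hi
      simp [hi]
    · simp
  simp only [h]
  rw [← Fintype.prod_sum (fun i k => f i k * if h : i = i₀ then G (h ▸ k) else 1),
    Finset.prod_eq_single i₀]
  · simp
  · intro i _ hi
    simp [hi, hf i]
  · simp

section Gluing

variable {Y : Type*} [MetricSpace Y] [MeasurableSpace Y] [BorelSpace Y]

/-- A coupling of a measure on a finite set with `ν` is given by densities with respect to `ν`. -/
lemma exists_density_of_coupling (p : ℝ) {s : Finset Y} {μ ν : Measure Y}
    (hμ : μ ∈ probOn (s : Set Y)) [IsProbabilityMeasure ν] {π : Measure (Y × Y)}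
    (hπ : π ∈ couplings μ ν) :
    ∃ f : s → Y → ℝ≥0∞, (∀ k, Measurable (f k)) ∧ (∀ k, ∫⁻ y, f k y ∂ν = μ {(k : Y)}) ∧
      (∀ᵐ y ∂ν, ∑ k, f k y = 1) ∧
      ∫⁻ z, edist z.1 z.2 ^ p ∂π = ∫⁻ y, ∑ k : s, f k y * edist (k : Y) y ^ p ∂ν := by
  obtain ⟨h1, h2⟩ := hπ
  have := hμ.1
  have : IsProbabilityMeasure π := ⟨by rw [← Measure.fst_univ, h1, measure_univ]⟩
  let E : s → Set (Y × Y) := fun k => Prod.fst ⁻¹' {(k : Y)}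
  have hE : ∀ k, MeasurableSet (E k) := fun k => measurable_fst (measurableSet_singleton _)
  have c1 : π (Prod.fst ⁻¹' (s : Set Y)ᶜ) = 0 := by
    rw [← Measure.fst_apply s.measurableSet.compl, h1]
    exact hμ.2
  have hsum : π = ∑ k, π.restrict (E k) := by
    ext B hB
    simp only [Measure.finsetSum_apply, Measure.restrict_apply hB]
    rw [← measure_inter_conull (t := Prod.fst ⁻¹' (s : Set Y)) c1, ← measure_biUnion_finset]
    · congr 1
      ext z
      simp [E]
    · intro i _ j _ hij
      refine Set.disjoint_left.2 fun z hz hz' => hij (Subtype.ext ?_)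
      exact hz.2.symm.trans hz'.2
    · exact fun k _ => hB.inter (hE k)
  -- `η k` is the share of `ν` coupled with the point `k`. As `s` is finite, Radon–Nikodym densities
  -- of these shares replace a disintegration, without any completeness or separability of `Y`.
  let η : s → Measure Y := fun k => (π.restrict (E k)).map Prod.snd
  have hηle : ∀ k, η k ≤ ν := fun k => by
    rw [← h2]
    exact Measure.map_mono Measure.restrict_le_self measurable_snd
  have hηsum : ∑ k, η k = ν := by
    ext B hB
    rw [← h2, Measure.snd_apply hB]
    conv_rhs => rw [hsum]
    simp only [η, Measure.finsetSum_apply, Measure.map_apply measurable_snd hB]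
  have hd : ∀ k, ν.withDensity ((η k).rnDeriv ν) = η k := fun k => by
    have : IsFiniteMeasure (η k) := isFiniteMeasure_of_le ν (hηle k)
    exact Measure.withDensity_rnDeriv_eq _ _ (Measure.absolutelyContinuous_of_le (hηle k))
  have hmeas : ∀ k, Measurable ((η k).rnDeriv ν) := fun k => Measure.measurable_rnDeriv _ _
  refine ⟨fun k => (η k).rnDeriv ν, hmeas, fun k => ?_, ?_, ?_⟩
  · rw [← setLIntegral_univ, ← withDensity_apply _ MeasurableSet.univ, hd,
      Measure.map_apply measurable_snd MeasurableSet.univ, Set.preimage_univ,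
      Measure.restrict_apply_univ, ← h1, Measure.fst_apply (measurableSet_singleton _)]
  · have : ν.withDensity (fun y => ∑ k, (η k).rnDeriv ν y) = ν.withDensity 1 := by
      rw [withDensity_one]
      conv_rhs => rw [← hηsum]
      ext B hB
      rw [withDensity_apply _ hB, lintegral_finsetSum _ fun k _ => hmeas k,
        Measure.finsetSum_apply]
      refine Finset.sum_congr rfl fun k _ => ?_
      rw [← withDensity_apply _ hB, hd]
    exact (withDensity_eq_iff_of_sigmaFinite
      (Finset.measurable_sum _ fun k _ => hmeas k).aemeasurable aemeasurable_const).1 this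
  · conv_lhs => rw [hsum]
    rw [lintegral_finsetSum_measure]
    have hm : ∀ k : s, Measurable fun y : Y => edist (k : Y) y ^ p := fun k =>
      (continuous_const.edist continuous_id).measurable.pow_const p
    rw [lintegral_finsetSum (f := fun k y => (η k).rnDeriv ν y * edist (k : Y) y ^ p) _
      fun k _ => (hmeas k).mul (hm k)]
    refine Finset.sum_congr rfl fun k _ => ?_
    have e1 : ∫⁻ z in E k, edist z.1 z.2 ^ p ∂π = ∫⁻ z in E k, edist (k : Y) z.2 ^ p ∂π :=
      setLIntegral_congr_fun (hE k) fun z hz => by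
        have : z.1 = k := hz
        rw [this]
    rw [e1, ← lintegral_map (f := fun y => edist (k : Y) y ^ p) (hm k) measurable_snd]
    change ∫⁻ y, edist (k : Y) y ^ p ∂(η k) = _
    conv_lhs => rw [← hd k]
    rw [lintegral_withDensity_eq_lintegral_mul _ (hmeas k) (hm k)]
    rfl

variable {N : ℕ} {p : ℝ} {C : Finset Y} {s : Fin N → Finset Y} {m : Fin N → Measure Y}

/-- The mass `∫ ∏ᵢ fᵢ(κᵢ) dν` of a tuple `κ`, transported to the point `c κ`, gives a feasible
point of the linear program. -/
lemma exists_mem_lpFeasible_of_multicoupling (M : (∀ i, s i) → ℝ) (hM : ∀ κ, 0 ≤ M κ)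
    (c : (∀ i, s i) → C)
    (hmarg : ∀ i (k : s i), (∑ κ, open Classical in if κ i = k then M κ else 0) =
      (m i).real {(k : Y)}) :
    ∃ z ∈ lpFeasible C s m, lpCost p C s z =
      (1 / (N : ℝ)) * ∑ κ, M κ * ∑ i, dist (c κ : Y) (κ i : Y) ^ p := by
  classical
  refine ⟨(fun i j k => ∑ κ, if c κ = j ∧ κ i = k then M κ else 0,
    fun j => ∑ κ, if c κ = j then M κ else 0), ⟨fun i j => ?_, fun i k => ?_, fun i j k => ?_⟩, ?_⟩
  · dsimp only
    rw [Finset.sum_comm]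
    refine Finset.sum_congr rfl fun κ _ => ?_
    by_cases h : c κ = j <;> simp [h]
  · dsimp only
    rw [← hmarg i k, Finset.sum_comm]
    refine Finset.sum_congr rfl fun κ _ => ?_
    by_cases h : κ i = k <;> simp [h]
  · exact Finset.sum_nonneg fun κ _ => by split_ifs <;> simp [hM]
  · simp only [lpCost]
    congr 1
    have : ∀ i, ∑ j : C, ∑ k : s i, (∑ κ : ∀ i, s i, if c κ = j ∧ κ i = k then M κ else 0) *
        dist (j : Y) (k : Y) ^ p = ∑ κ, M κ * dist (c κ : Y) (κ i : Y) ^ p := by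
      intro i
      simp only [Finset.sum_mul, ite_mul, zero_mul, ite_and]
      have h3 : ∀ j : C, ∑ k : s i, ∑ κ : ∀ i, s i,
          (if c κ = j then if κ i = k then M κ * dist (j : Y) (k : Y) ^ p else 0 else 0) =
          ∑ κ, if c κ = j then M κ * dist (j : Y) (κ i : Y) ^ p else 0 := fun j => by
        rw [Finset.sum_comm]
        refine Finset.sum_congr rfl fun κ _ => ?_
        by_cases h : c κ = j <;> simp [h]
      simp only [h3]
      rw [Finset.sum_comm]
      simp
    simp only [this]
    rw [Finset.sum_comm]
    simp only [Finset.mul_sum]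

open Classical in
/-- The excess of the cost of the tuples at `y` over their minimal cost. -/
noncomputable def excess (p : ℝ) (s : Fin N → Finset Y) (c : (∀ i, s i) → Y) (y : Y) : ℝ≥0∞ :=
  ⨅ κ : ∀ i, s i, ENNReal.ofReal (∑ i, dist (κ i : Y) y ^ p - ∑ i, dist (κ i : Y) (c κ) ^ p)

lemma measurable_excess (hp : 1 ≤ p) (c : (∀ i, s i) → Y) : Measurable (excess p s c) := by
  refine Measurable.iInf fun κ => ENNReal.measurable_ofReal.comp (Continuous.measurable ?_)
  refine Continuous.sub (continuous_finsetSum _ fun i _ => ?_) continuous_const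
  exact (continuous_const.dist continuous_id).rpow_const fun _ => Or.inr (by linarith)

/-- The infimum over the finitely many tuples is attained; if it vanishes, then for some tuple `y`
does as well as the chosen centroid. -/
lemma mem_centroidSet_of_excess_eq_zero [∀ i, Nonempty (s i)] {c : (∀ i, s i) → Y}
    (hc : ∀ κ, IsCentroid p (fun i => (κ i : Y)) (c κ)) {y : Y} (hy : excess p s c y = 0) :
    y ∈ centroidSet p s := by
  obtain ⟨κ, hκ⟩ := exists_eq_ciInf_of_finite (f := fun κ : ∀ i, s i =>
    ENNReal.ofReal (∑ i, dist (κ i : Y) y ^ p - ∑ i, dist (κ i : Y) (c κ) ^ p))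
  have h0 := hκ.trans hy
  rw [ENNReal.ofReal_eq_zero, sub_nonpos] at h0
  exact ⟨fun i => κ i, fun i => (κ i).2, fun z => h0.trans (hc κ z)⟩

/-- Given `y`, the densities are probability vectors, and their product `F κ y` glues the `N`
couplings along `ν`. A tuple `κ` served from `y` pays its centroid cost plus at least the excess at
`y`. Sending the mass of each `κ` to `c κ` instead gives a feasible point, so the centroid costs sum
to at least `N` times the value of the program. -/
lemma sum_cost_ge_of_couplings (hp : 1 ≤ p) (hN : 1 ≤ N)
    (hm : ∀ i, m i ∈ probOn (s i : Set Y)) (c : (∀ i, s i) → C)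
    (hc : ∀ κ, IsCentroid p (fun i => (κ i : Y)) (c κ)) (ν : Measure Y) [IsProbabilityMeasure ν]
    {π : Fin N → Measure (Y × Y)} (hπ : ∀ i, π i ∈ couplings (m i) ν) :
    (N : ℝ≥0∞) * ENNReal.ofReal (lpValue p C s m) + ∫⁻ y, excess p s (fun κ => c κ) y ∂ν ≤
      ∑ i, ∫⁻ z, edist z.1 z.2 ^ p ∂(π i) := by
  classical
  choose f hf1 hf2 hf3 hf4 using fun i => exists_density_of_coupling p (hm i) (hπ i)
  have hf3' : ∀ᵐ y ∂ν, ∀ i, ∑ k, f i k y = 1 := ae_all_iff.2 hf3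
  let F : (∀ i, s i) → Y → ℝ≥0∞ := fun κ y => ∏ i, f i (κ i) y
  have hF : ∀ κ, Measurable (F κ) := fun κ => Finset.measurable_prod _ fun i _ => hf1 i _
  let mc : (∀ i, s i) → ℝ := fun κ => ∑ i, dist (κ i : Y) (c κ : Y) ^ p
  have hmc : ∀ κ, 0 ≤ mc κ := fun κ =>
    Finset.sum_nonneg fun i _ => Real.rpow_nonneg dist_nonneg _
  have hmargE : ∀ i (k : s i), ∑ κ, (if κ i = k then ∫⁻ y, F κ y ∂ν else 0) = m i {(k : Y)} := by
    intro i k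
    have : ∀ κ : ∀ i, s i, (if κ i = k then ∫⁻ y, F κ y ∂ν else 0) =
        ∫⁻ y, F κ y * (if κ i = k then 1 else 0) ∂ν := fun κ => by split_ifs <;> simp
    simp only [this]
    rw [← lintegral_finsetSum _ fun κ _ => (hF κ).mul_const _, ← hf2 i k]
    refine lintegral_congr_ae ?_
    filter_upwards [hf3'] with y hy
    have := sum_prod_mul_eq (fun i k => f i k y) hy i fun l => if l = k then 1 else 0
    simpa using this
  have hfin : ∀ κ, ∫⁻ y, F κ y ∂ν ≠ ∞ := fun κ => by
    have := hm ⟨0, hN⟩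
    have := this.1
    refine ne_top_of_le_ne_top (measure_ne_top (m ⟨0, hN⟩) {(κ ⟨0, hN⟩ : Y)}) ?_
    rw [← hmargE]
    refine le_trans (by simp) (Finset.single_le_sum (f := fun κ' : ∀ i, s i =>
      if κ' ⟨0, hN⟩ = κ ⟨0, hN⟩ then ∫⁻ y, F κ' y ∂ν else 0) (fun _ _ => bot_le)
      (Finset.mem_univ κ))
  obtain ⟨z, hz, hzc⟩ := exists_mem_lpFeasible_of_multicoupling (p := p) (m := m)
    (fun κ => (∫⁻ y, F κ y ∂ν).toReal) (fun κ => ENNReal.toReal_nonneg) c (fun i k => by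
      rw [Measure.real, ← hmargE i k, ENNReal.toReal_sum fun κ _ => by
        split_ifs <;> simp [hfin]]
      refine Finset.sum_congr rfl fun κ _ => ?_
      split_ifs <;> simp)
  have hCne : C.Nonempty := by
    have : ∀ i, Nonempty (s i) := fun i => by
      by_contra h
      have h1 := sum_measureReal_of_mem_probOn (hm i)
      rw [not_nonempty_iff] at h
      simp at h1
    exact ⟨c (Classical.arbitrary _), (c _).2⟩
  have hval : (N : ℝ≥0∞) * ENNReal.ofReal (lpValue p C s m) ≤
      ∑ κ, (∫⁻ y, F κ y ∂ν) * ENNReal.ofReal (mc κ) := by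
    have hN' : (N : ℝ) ≠ 0 := by positivity
    have h1 : (N : ℝ) * lpValue p C s m ≤ ∑ κ, (∫⁻ y, F κ y ∂ν).toReal * mc κ := by
      have h2 := mul_le_mul_of_nonneg_left (lpValue_le (p := p) hN hm hCne hz)
        (Nat.cast_nonneg' N : (0 : ℝ) ≤ N)
      rw [hzc, ← mul_assoc, mul_one_div_cancel hN', one_mul] at h2
      simpa only [mc, dist_comm] using h2
    have h3 := ENNReal.ofReal_le_ofReal h1
    rw [ENNReal.ofReal_mul (Nat.cast_nonneg' N), ENNReal.ofReal_natCast,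
      ENNReal.ofReal_sum_of_nonneg fun κ _ => mul_nonneg ENNReal.toReal_nonneg (hmc κ)] at h3
    refine h3.trans_eq (Finset.sum_congr rfl fun κ _ => ?_)
    rw [ENNReal.ofReal_mul ENNReal.toReal_nonneg, ENNReal.ofReal_toReal (hfin κ)]
  have hexc := measurable_excess (p := p) (s := s) hp fun κ => (c κ : Y)
  have hd : ∀ x : Y, Measurable fun y : Y => edist x y ^ p := fun x =>
    (continuous_const.edist continuous_id).measurable.pow_const p
  calc _ ≤ ∑ κ, (∫⁻ y, F κ y ∂ν) * ENNReal.ofReal (mc κ) +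
        ∫⁻ y, excess p s (fun κ => c κ) y ∂ν := add_le_add hval le_rfl
    _ = ∫⁻ y, (∑ κ, F κ y * ENNReal.ofReal (mc κ) + excess p s (fun κ => c κ) y) ∂ν := by
        rw [lintegral_add_right _ hexc, lintegral_finsetSum _ fun κ _ => (hF κ).mul_const _]
        congr 1
        exact Finset.sum_congr rfl fun κ _ => (lintegral_mul_const _ (hF κ)).symm
    _ ≤ ∫⁻ y, ∑ i, ∑ k : s i, f i k y * edist (k : Y) y ^ p ∂ν := by
        refine lintegral_mono_ae ?_
        filter_upwards [hf3'] with y hy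
        have h1 : ∑ κ, F κ y = 1 := by
          have := sum_prod_mul_eq (fun i k => f i k y) hy ⟨0, hN⟩ fun _ => 1
          simp only [mul_one] at this
          exact this.trans (hy _)
        have h2 : ∀ i, ∑ k : s i, f i k y * edist (k : Y) y ^ p =
            ∑ κ, F κ y * edist (κ i : Y) y ^ p := fun i =>
          (sum_prod_mul_eq (fun i k => f i k y) hy i fun k => edist (k : Y) y ^ p).symm
        simp only [h2]
        rw [Finset.sum_comm, ← one_mul (excess p s (fun κ => c κ) y), ← h1, Finset.sum_mul,
          ← Finset.sum_add_distrib]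
        refine Finset.sum_le_sum fun κ _ => ?_
        rw [← Finset.mul_sum, ← mul_add]
        gcongr
        have h3 : ∑ i, edist (κ i : Y) y ^ p = ENNReal.ofReal (∑ i, dist (κ i : Y) y ^ p) := by
          rw [ENNReal.ofReal_sum_of_nonneg fun i _ => Real.rpow_nonneg dist_nonneg _]
          refine Finset.sum_congr rfl fun i _ => ?_
          rw [← ENNReal.ofReal_rpow_of_nonneg dist_nonneg (by linarith), edist_dist]
        rw [h3]
        refine (add_le_add le_rfl (iInf_le _ κ)).trans ?_
        rw [← ENNReal.ofReal_add (hmc κ) (sub_nonneg.2 (hc κ y))]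
        exact ENNReal.ofReal_le_ofReal (by simp only [mc]; linarith)
    _ = _ := by
        rw [lintegral_finsetSum (f := fun i y => ∑ k : s i, f i k y * edist (k : Y) y ^ p) _
          fun i _ => Finset.measurable_sum _ fun k _ => (hf1 i k).mul (hd k)]
        exact Finset.sum_congr rfl fun i _ => (hf4 i).symm

end Gluing

/-! ### Barycenters and minimisers of the linear program -/

section Barycenters

variable {Y : Type*} [MetricSpace Y] [MeasurableSpace Y] [BorelSpace Y] {N : ℕ} {p : ℝ}
  {C : Finset Y} {s : Fin N → Finset Y} {m : Fin N → Measure Y}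

/-- Reduces a lower bound on the functional to arbitrary tuples of couplings, so that no optimal
coupling has to exist: near-optimal ones with slack `ε / N` each are enough. -/
lemma le_frechet (hp : 1 ≤ p) (hN : 1 ≤ N) {ν : Measure Y} {b : ℝ≥0∞}
    (h : ∀ π : Fin N → Measure (Y × Y), (∀ i, π i ∈ couplings (m i) ν) →
      (N : ℝ≥0∞) * b ≤ ∑ i, ∫⁻ z, edist z.1 z.2 ^ p ∂(π i)) : b ≤ frechet p m ν := by
  have hN0 : (N : ℝ≥0∞) ≠ 0 := by simpa using (by omega : N ≠ 0)
  have hNt : (N : ℝ≥0∞) ≠ ∞ := ENNReal.natCast_ne_top N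
  rw [frechet, ← ENNReal.div_eq_inv_mul, ENNReal.le_div_iff_mul_le (Or.inl hN0) (Or.inl hNt),
    mul_comm]
  simp only [wasserstein_rpow hp]
  refine ENNReal.le_of_forall_pos_le_add fun ε hε hlt => ?_
  have hε' : (ε : ℝ≥0∞) / N ≠ 0 := (ENNReal.div_pos (by positivity) hNt).ne'
  have hex : ∀ i, ∃ π ∈ couplings (m i) ν, ∫⁻ z, edist z.1 z.2 ^ p ∂π <
      (⨅ π ∈ couplings (m i) ν, ∫⁻ z, edist z.1 z.2 ^ p ∂π) + ε / N := fun i => by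
    have hi := ENNReal.lt_add_right (ENNReal.sum_lt_top.1 hlt i (Finset.mem_univ i)).ne hε'
    simpa only [iInf_lt_iff, exists_prop] using hi
  choose π hπ hπ' using hex
  refine (h π hπ).trans ((Finset.sum_le_sum fun i _ => (hπ' i).le).trans_eq ?_)
  rw [Finset.sum_add_distrib, Finset.sum_const, Finset.card_univ, Fintype.card_fin, nsmul_eq_mul,
    ENNReal.mul_div_cancel hN0 hNt]

lemma frechet_atomic_le (hp : 1 ≤ p) (hN : 1 ≤ N) (hm : ∀ i, m i ∈ probOn (s i : Set Y))
    {z : LPVar C s} (hz : z ∈ lpFeasible C s m) :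
    frechet p m (atomic C z.2) ≤ ENNReal.ofReal (lpCost p C s z) := by
  have h : ∀ i, wasserstein p (m i) (atomic C z.2) ^ p ≤
      ENNReal.ofReal (∑ j : C, ∑ k : s i, z.1 i j k * dist (j : Y) (k : Y) ^ p) := fun i => by
    have := wasserstein_atomic_le hp (s i) C (mem_lpFeasible_iff.1 hz i)
    rw [atomic_of_mem_probOn (hm i), Finset.sum_comm] at this
    simpa only [dist_comm] using this
  have h0 : ∀ i, 0 ≤ ∑ j : C, ∑ k : s i, z.1 i j k * dist (j : Y) (k : Y) ^ p := fun i =>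
    Finset.sum_nonneg fun j _ => Finset.sum_nonneg fun k _ =>
      mul_nonneg (hz.2.2 i j k) (Real.rpow_nonneg dist_nonneg _)
  rw [frechet, lpCost, ENNReal.ofReal_mul (by positivity), one_div,
    ENNReal.ofReal_inv_of_pos (by positivity), ENNReal.ofReal_natCast,
    ENNReal.ofReal_sum_of_nonneg fun i _ => h0 i]
  gcongr with i
  exact h i

/-- For a measure on `C` the value of the Fréchet functional is attained in the linear program. -/
lemma exists_mem_lpFeasible_le_frechet (hp : 1 ≤ p) (hN : 1 ≤ N)
    (hm : ∀ i, m i ∈ probOn (s i : Set Y)) {ν : Measure Y} (hν : ν ∈ probOn (C : Set Y)) :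
    ∃ z ∈ lpFeasible C s m, atomic C z.2 = ν ∧
      ENNReal.ofReal (lpCost p C s z) ≤ frechet p m ν := by
  set a : C → ℝ := fun j => ν.real {(j : Y)} with ha
  have hcomp : IsCompact {z : LPVar C s | z ∈ lpFeasible C s m ∧ z.2 = a} :=
    (isCompact_lpFeasible hN hm).inter_right (isClosed_eq continuous_snd continuous_const)
  have hne : {z : LPVar C s | z ∈ lpFeasible C s m ∧ z.2 = a}.Nonempty := by
    refine ⟨(fun i j k => (m i).real {(k : Y)} * a j, a), ⟨fun i j => ?_, fun i k => ?_,
      fun i j k => mul_nonneg measureReal_nonneg measureReal_nonneg⟩, rfl⟩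
    · rw [← Finset.sum_mul, sum_measureReal_of_mem_probOn (hm i), one_mul]
    · rw [← Finset.mul_sum, sum_measureReal_of_mem_probOn hν, mul_one]
  -- The minimiser with weights `a` is fixed before the couplings are, since one `z` must beat all
  -- of them.
  obtain ⟨z, hz, hmin⟩ := hcomp.exists_isMinOn hne (continuous_lpCost (p := p)).continuousOn
  refine ⟨z, hz.1, by rw [hz.2]; exact atomic_of_mem_probOn hν, le_frechet hp hN fun π hπ => ?_⟩
  choose γ hγ hγ' using fun i => exists_isPlan_of_coupling hp (hm i) hν (hπ i)
  have hw : ((fun i j k => γ i k j, a) : LPVar C s) ∈ lpFeasible C s m :=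
    mem_lpFeasible_iff.2 hγ
  have h1 : lpCost p C s z ≤ lpCost p C s (fun i j k => γ i k j, a) := hmin ⟨hw, rfl⟩
  have hN' : (N : ℝ) ≠ 0 := by positivity
  have h2 := mul_le_mul_of_nonneg_left h1 (Nat.cast_nonneg' N : (0 : ℝ) ≤ N)
  conv at h2 => rhs; rw [lpCost, ← mul_assoc, mul_one_div_cancel hN', one_mul]
  simp only [hγ']
  rw [← ENNReal.ofReal_natCast, ← ENNReal.ofReal_mul (Nat.cast_nonneg' N),
    ← ENNReal.ofReal_sum_of_nonneg fun i _ => Finset.sum_nonneg fun k _ =>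
      Finset.sum_nonneg fun j _ => mul_nonneg ((hγ i).1 k j) (Real.rpow_nonneg dist_nonneg _)]
  refine ENNReal.ofReal_le_ofReal (h2.trans_eq (Finset.sum_congr rfl fun i _ => ?_))
  rw [Finset.sum_comm]
  simp only [dist_comm]

lemma atomic_snd_mem_probOn (hN : 1 ≤ N) (hm : ∀ i, m i ∈ probOn (s i : Set Y)) {z : LPVar C s}
    (hz : z ∈ lpFeasible C s m) : atomic C z.2 ∈ probOn (C : Set Y) :=
  atomic_mem_probOn C (snd_nonneg_of_mem_lpFeasible hN hz) (sum_snd_of_mem_lpFeasible hN hm hz)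

/-- The functional at the weights of a feasible point never exceeds its objective, and every measure
on `C` has a feasible point for which the objective is no larger than the functional. So minimisers
correspond. -/
lemma mem_barycenters_finset_iff (hp : 1 ≤ p) (hN : 1 ≤ N)
    (hm : ∀ i, m i ∈ probOn (s i : Set Y)) {ν : Measure Y} :
    ν ∈ barycenters p (C : Set Y) m ↔ ∃ z ∈ lpMinimisers p C s m, atomic C z.2 = ν := by
  constructor
  · rintro ⟨hν, hmin⟩
    obtain ⟨z, hz, hzν, hle⟩ := exists_mem_lpFeasible_le_frechet (p := p) hp hN hm hν
    refine ⟨z, ⟨hz, fun w hw => ?_⟩, hzν⟩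
    exact (ENNReal.ofReal_le_ofReal_iff (lpCost_nonneg hw)).1
      (hle.trans ((hmin _ (atomic_snd_mem_probOn hN hm hw)).trans
        (frechet_atomic_le hp hN hm hw)))
  · rintro ⟨z, hz, rfl⟩
    refine ⟨atomic_snd_mem_probOn hN hm hz.1, fun ρ hρ => ?_⟩
    obtain ⟨w, hw, -, hle⟩ := exists_mem_lpFeasible_le_frechet (p := p) hp hN hm hρ
    exact (frechet_atomic_le hp hN hm hz.1).trans
      ((ENNReal.ofReal_le_ofReal (hz.2 w hw)).trans hle)

lemma nonempty_of_mem_probOn {F : Finset Y} {ν : Measure Y} (h : ν ∈ probOn (F : Set Y)) :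
    F.Nonempty := by
  by_contra hF
  rw [Finset.not_nonempty_iff_eq_empty] at hF
  subst hF
  simpa using sum_measureReal_of_mem_probOn h

/-- If `C` is the set of all the centroids, then the barycenters in the whole space are those among
the measures on `C`. -/
lemma barycenters_univ_eq (hp : 1 ≤ p) (hN : 1 ≤ N) (hm : ∀ i, m i ∈ probOn (s i : Set Y))
    (hC : (C : Set Y) = centroidSet p s)
    (hC' : ∀ x : Fin N → Y, (∀ i, x i ∈ s i) → ∃ c ∈ C, IsCentroid p x c) :
    barycenters p Set.univ m = barycenters p (C : Set Y) m := by
  have hne : ∀ i, Nonempty (s i) := fun i => (nonempty_of_mem_probOn (hm i)).to_subtype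
  choose c₀ hc₀ hc using fun κ : ∀ i, s i => hC' (fun i => κ i) fun i => (κ i).2
  let c : (∀ i, s i) → C := fun κ => ⟨c₀ κ, hc₀ κ⟩
  have hCne : C.Nonempty := ⟨c (Classical.arbitrary _), (c _).2⟩
  have hN0 : (N : ℝ≥0∞) ≠ 0 := by simpa using (by omega : N ≠ 0)
  have hNt : (N : ℝ≥0∞) ≠ ∞ := ENNReal.natCast_ne_top N
  have key : ∀ ν : Measure Y, IsProbabilityMeasure ν →
      ENNReal.ofReal (lpValue p C s m) + (∫⁻ y, excess p s (fun κ => c κ) y ∂ν) / N ≤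
        frechet p m ν := fun ν hν => le_frechet hp hN fun π hπ => by
    rw [mul_add, ENNReal.mul_div_cancel hN0 hNt]
    exact sum_cost_ge_of_couplings hp hN hm c hc ν hπ
  obtain ⟨z, hz⟩ := lpMinimisers_nonempty (p := p) hN hm hCne
  have hzle : frechet p m (atomic C z.2) ≤ ENNReal.ofReal (lpValue p C s m) := by
    rw [← lpCost_eq_lpValue hz]
    exact frechet_atomic_le hp hN hm hz.1
  have hzC := atomic_snd_mem_probOn hN hm hz.1
  have huniv : ∀ {ν : Measure Y}, ν ∈ probOn (C : Set Y) → ν ∈ probOn (Set.univ : Set Y) :=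
    fun h => ⟨h.1, by simp⟩
  ext ν
  constructor
  · rintro ⟨hν, hmin⟩
    -- The lower bound with excess meets the upper bound given by the program, so the excess
    -- vanishes `ν`-almost everywhere, that is, `ν` lives on the centroids.
    have h1 := (key ν hν.1).trans ((hmin _ (huniv hzC)).trans hzle)
    have h2 : (∫⁻ y, excess p s (fun κ => c κ) y ∂ν) / N = 0 := by
      by_contra h0
      exact absurd h1 (not_le.2 (ENNReal.lt_add_right ENNReal.ofReal_ne_top h0))
    rw [ENNReal.div_eq_zero_iff, or_iff_left hNt,
      lintegral_eq_zero_iff (measurable_excess hp _)] at h2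
    have h3 : ν {y | ¬ excess p s (fun κ => (c κ : Y)) y = 0} = 0 := ae_iff.1 h2
    refine ⟨⟨hν.1, ?_⟩, fun ρ hρ => hmin ρ (huniv hρ)⟩
    refine measure_mono_null ?_ h3
    intro y hy h0
    apply hy
    rw [hC]
    exact mem_centroidSet_of_excess_eq_zero hc h0
  · rintro ⟨hν, hmin⟩
    refine ⟨huniv hν, fun ρ hρ => (hmin _ hzC).trans (hzle.trans ?_)⟩
    exact le_self_add.trans (key ρ hρ.1)

end Barycenters

end WassersteinBarycenter

namespace WassersteinBarycenter

/-! ### Deviations of the empirical measure -/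

section Empirical

variable {Y : Type*} [MeasurableSpace Y] {Ω : Type*} [MeasurableSpace Ω] {P : Measure Ω}
  {S : ℕ} {ξ : Fin S → Ω → Y} {μ : Measure Y}

lemma empirical_real (x : Fin S → Y) {T : Set Y} (hT : MeasurableSet T) :
    (empirical x).real T = (S : ℝ)⁻¹ * ∑ k, T.indicator (fun _ => (1 : ℝ)) (x k) := by
  classical
  simp only [empirical, Measure.real, Measure.smul_apply, Measure.finsetSum_apply, smul_eq_mul,
    Measure.dirac_apply' _ hT, ENNReal.toReal_mul, ENNReal.toReal_inv, ENNReal.toReal_natCast]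
  congr 1
  rw [ENNReal.toReal_sum fun k _ => by by_cases h : x k ∈ T <;> simp [h]]
  refine Finset.sum_congr rfl fun k _ => ?_
  by_cases h : x k ∈ T <;> simp [h]

lemma empirical_mem_probOn (hS : 1 ≤ S) {x : Fin S → Y} {A : Set Y} (hA : MeasurableSet A)
    (hx : ∀ k, x k ∈ A) : empirical x ∈ probOn A := by
  refine ⟨⟨?_⟩, ?_⟩
  · simp only [empirical, Measure.smul_apply, Measure.finsetSum_apply, measure_univ, smul_eq_mul,
      Finset.sum_const, Finset.card_univ, Fintype.card_fin, nsmul_eq_mul, mul_one]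
    exact ENNReal.inv_mul_cancel (by simpa using (by omega : S ≠ 0)) (ENNReal.natCast_ne_top S)
  · simp only [empirical, Measure.smul_apply, Measure.finsetSum_apply, smul_eq_mul,
      Measure.dirac_apply' _ hA.compl]
    simp [hx]

instance isFiniteMeasure_empirical {Y : Type*} [MeasurableSpace Y] {S : ℕ} (x : Fin S → Y) : IsFiniteMeasure (empirical x) := by
  rcases Nat.eq_zero_or_pos S with rfl | hS
  -- For `S = 0` the scalar is `∞`, but it multiplies the zero measure.
  · simp only [empirical, Finset.univ_eq_empty, Finset.sum_empty, smul_zero]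
    infer_instance
  · have := (empirical_mem_probOn hS (x := x) MeasurableSet.univ fun _ => trivial).1
    infer_instance

variable [IsProbabilityMeasure P]

lemma memLp_indicator_comp (hlaw : ∀ k, HasLaw (ξ k) μ P) {T : Set Y} (hT : MeasurableSet T)
    (k : Fin S) (q : ℝ≥0∞) : MemLp (fun ω => T.indicator (fun _ => (1 : ℝ)) (ξ k ω)) q P := by
  refine MemLp.of_bound (((measurable_const.indicator hT).comp_aemeasurable
    (hlaw k).aemeasurable).aestronglyMeasurable) 1 (Filter.Eventually.of_forall fun ω => ?_)
  by_cases h : ξ k ω ∈ T <;> simp [h]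

lemma integral_indicator_comp (hlaw : ∀ k, HasLaw (ξ k) μ P) {T : Set Y} (hT : MeasurableSet T)
    (k : Fin S) : ∫ ω, T.indicator (fun _ => (1 : ℝ)) (ξ k ω) ∂P = μ.real T := by
  have := (hlaw k).integral_comp (f := T.indicator fun _ => (1 : ℝ))
    (measurable_const.indicator hT).aestronglyMeasurable
  rw [integral_indicator_const _ hT, smul_eq_mul, mul_one] at this
  exact this

lemma memLp_empirical_real (hlaw : ∀ k, HasLaw (ξ k) μ P) {T : Set Y} (hT : MeasurableSet T)
    (q : ℝ≥0∞) : MemLp (fun ω => (empirical fun k => ξ k ω).real T) q P := by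
  simp only [empirical_real _ hT]
  exact (memLp_finsetSum _ fun k _ => memLp_indicator_comp hlaw hT k q).const_mul _

lemma integral_empirical_real (hS : 1 ≤ S) (hlaw : ∀ k, HasLaw (ξ k) μ P) {T : Set Y}
    (hT : MeasurableSet T) : ∫ ω, (empirical fun k => ξ k ω).real T ∂P = μ.real T := by
  simp only [empirical_real _ hT]
  rw [integral_const_mul, integral_finsetSum _ fun k _ =>
    (memLp_indicator_comp hlaw hT k 1).integrable le_rfl]
  simp only [integral_indicator_comp hlaw hT, Finset.sum_const, Finset.card_univ, Fintype.card_fin,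
    nsmul_eq_mul]
  have : (S : ℝ) ≠ 0 := by positivity
  field_simp

lemma variance_empirical_real_le (hS : 1 ≤ S) (hlaw : ∀ k, HasLaw (ξ k) μ P)
    (hindep : iIndepFun ξ P) {T : Set Y} (hT : MeasurableSet T) :
    Var[fun ω => (empirical fun k => ξ k ω).real T; P] ≤ μ.real T / S := by
  have hg : Measurable (T.indicator fun _ => (1 : ℝ)) := measurable_const.indicator hT
  have hv : ∀ k, Var[fun ω => T.indicator (fun _ => (1 : ℝ)) (ξ k ω); P] ≤ μ.real T := fun k => by
    refine (variance_le_expectation_sq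
      (memLp_indicator_comp hlaw hT k 1).aestronglyMeasurable).trans_eq ?_
    rw [← integral_indicator_comp hlaw hT k]
    refine integral_congr_ae (Filter.Eventually.of_forall fun ω => ?_)
    by_cases h : ξ k ω ∈ T <;> simp [h]
  have hsum := IndepFun.variance_sum (μ := P) (s := Finset.univ)
    (X := fun k ω => T.indicator (fun _ => (1 : ℝ)) (ξ k ω))
    (fun k _ => memLp_indicator_comp hlaw hT k 2) fun i _ j _ hij =>
      (hindep.comp (fun _ => T.indicator fun _ => (1 : ℝ)) fun _ => hg).indepFun hij
  simp only [empirical_real _ hT]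
  rw [variance_const_mul]
  have e : (fun ω => ∑ k, T.indicator (fun _ => (1 : ℝ)) (ξ k ω)) =
      ∑ k, fun ω => T.indicator (fun _ => (1 : ℝ)) (ξ k ω) := by
    ext ω
    simp
  rw [e, hsum]
  calc _ ≤ ((S : ℝ)⁻¹) ^ 2 * ∑ _k : Fin S, μ.real T := by
        gcongr with k
        exact hv k
    _ = _ := by
        simp only [Finset.sum_const, Finset.card_univ, Fintype.card_fin, nsmul_eq_mul]
        have : (S : ℝ) ≠ 0 := by positivity
        field_simp

lemma integrable_abs_empirical_sub (hlaw : ∀ k, HasLaw (ξ k) μ P) {T : Set Y}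
    (hT : MeasurableSet T) :
    Integrable (fun ω => |(empirical fun k => ξ k ω).real T - μ.real T|) P :=
  (((memLp_empirical_real hlaw hT 1).integrable le_rfl).sub (integrable_const _)).abs

lemma integral_abs_empirical_sub_le (hS : 1 ≤ S) (hlaw : ∀ k, HasLaw (ξ k) μ P)
    (hindep : iIndepFun ξ P) {T : Set Y} (hT : MeasurableSet T) :
    ∫ ω, |(empirical fun k => ξ k ω).real T - μ.real T| ∂P ≤ √(μ.real T / S) := by
  refine Real.le_sqrt_of_sq_le ?_
  have hL : MemLp (fun ω => |(empirical fun k => ξ k ω).real T - μ.real T|) 2 P :=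
    ((memLp_empirical_real hlaw hT 2).sub (memLp_const _)).abs
  -- Nonnegativity of the variance of the absolute deviation says that its squared mean is at most
  -- its mean square.
  have h1 := variance_nonneg (fun ω => |(empirical fun k => ξ k ω).real T - μ.real T|) P
  rw [variance_eq_sub hL, sub_nonneg] at h1
  refine h1.trans (le_trans (le_of_eq ?_) (variance_empirical_real_le hS hlaw hindep hT))
  rw [variance_eq_integral (memLp_empirical_real hlaw hT 1).aestronglyMeasurable.aemeasurable,
    integral_empirical_real hS hlaw hT]
  simp

end Empirical

/-! ### The covering bound for the transport cost of the empirical measure -/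

section Covering

variable {Y : Type*} [MetricSpace Y] [MeasurableSpace Y] [BorelSpace Y]

lemma exists_map_card_le_coveringNumber (K : Finset Y) (δ : ℝ) (hδ : 0 ≤ δ) :
    ∃ f : K → K, (∀ x, dist x (f x) ≤ δ) ∧ ∃ R : Finset K, (∀ x, f x ∈ R) ∧
      R.card = (Metric.coveringNumber (Real.toNNReal δ) (K : Set Y)).toNat := by
  classical
  -- Needed because `toNat` would turn an infinite covering number into `0`.
  have hfin : Metric.coveringNumber (Real.toNNReal δ) (K : Set Y) ≠ ⊤ :=
    ne_top_of_le_ne_top (by simp) (Metric.coveringNumber_le_encard_self (K : Set Y))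
  obtain ⟨R, hRK, hR, hcov, hcard⟩ := Metric.exists_set_encard_eq_coveringNumber hfin
  have h : ∀ x : K, ∃ y : K, (y : Y) ∈ R ∧ dist x y ≤ δ := by
    intro x
    obtain ⟨y, hy, hxy⟩ := hcov (Finset.mem_coe.2 x.2)
    refine ⟨⟨y, hRK hy⟩, hy, ?_⟩
    have : edist (x : Y) y ≤ ((Real.toNNReal δ : ℝ≥0) : ℝ≥0∞) := hxy
    rw [edist_le_coe, ← NNReal.coe_le_coe, coe_nndist, Real.coe_toNNReal _ hδ] at this
    exact this
  choose f hf hfd using h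
  refine ⟨f, hfd, (hR.toFinset.subtype (· ∈ K)).map (Function.Embedding.refl _), fun x => ?_, ?_⟩
  · simpa using hf x
  · have : hR.toFinset.filter (· ∈ K) = hR.toFinset :=
      Finset.filter_true_of_mem fun x hx => Finset.mem_coe.1 (hRK (hR.mem_toFinset.1 hx))
    rw [Finset.card_map, Finset.card_subtype, this, ← hcard, hR.encard_eq_coe_toFinset_card, ENat.toNat_natCast]

variable {Ω : Type*} [MeasurableSpace Ω] {P : Measure Ω} [IsProbabilityMeasure P]
  {S : ℕ} {ξ : Fin S → Ω → Y} {μ : Measure Y}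

open Classical in
lemma push_measureReal_sub (K : Finset Y) (g : K → K) (ν ν' : Measure Y) [IsFiniteMeasure ν]
    [IsFiniteMeasure ν'] (y : K) :
    push g ((fun x : K => ν.real {(x : Y)}) - fun x : K => ν'.real {(x : Y)}) y =
      ν.real ((Finset.univ.filter (g · = y)).map (Function.Embedding.subtype _) : Finset Y) -
      ν'.real ((Finset.univ.filter (g · = y)).map (Function.Embedding.subtype _) : Finset Y) := by
  rw [← sum_measureReal_singleton, ← sum_measureReal_singleton, Finset.sum_map, Finset.sum_map,
    ← Finset.sum_sub_distrib, Finset.sum_filter]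
  refine Finset.sum_congr rfl fun x _ => ?_
  by_cases h : g x = y <;> simp [h]

lemma integrable_sum_abs_push (hlaw : ∀ k, HasLaw (ξ k) μ P) [IsProbabilityMeasure μ]
    (K : Finset Y) (g : K → K) :
    Integrable (fun ω => ∑ y, |push g ((fun x : K => (empirical fun k => ξ k ω).real {(x : Y)}) -
      fun x : K => μ.real {(x : Y)}) y|) P := by
  simp only [push_measureReal_sub]
  exact integrable_finsetSum _ fun y _ =>
    integrable_abs_empirical_sub hlaw (Finset.measurableSet _)

/-- The image at `y` is the deviation on the fibre of `g` over `y`, of mean at most the root of the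
mass of the fibre over `S`. The fibres are disjoint and only those over `R` are nonempty, so
Cauchy–Schwarz gives `√|R|`. -/
lemma integral_sum_abs_push_le (hS : 1 ≤ S) (hlaw : ∀ k, HasLaw (ξ k) μ P)
    (hindep : iIndepFun ξ P) [IsProbabilityMeasure μ] (K : Finset Y) (g : K → K) (R : Finset K)
    (hg : ∀ x, g x ∈ R) :
    ∫ ω, ∑ y, |push g ((fun x : K => (empirical fun k => ξ k ω).real {(x : Y)}) -
      fun x : K => μ.real {(x : Y)}) y| ∂P ≤ √(R.card : ℝ) * (S : ℝ) ^ (-(1 / 2 : ℝ)) := by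
  classical
  simp only [push_measureReal_sub]
  set T : K → Finset Y := fun y => (Finset.univ.filter (g · = y)).map
    (Function.Embedding.subtype _) with hT
  have hTR : ∀ y ∉ R, T y = ∅ := fun y hy => by
    simp only [T, Finset.map_eq_empty, Finset.filter_eq_empty_iff]
    rintro x - rfl
    exact hy (hg x)
  rw [integral_finsetSum _ fun y _ => integrable_abs_empirical_sub hlaw (Finset.measurableSet _)]
  have h1 : ∀ y, ∫ ω, |(empirical fun k => ξ k ω).real (T y : Set Y) - μ.real (T y : Set Y)| ∂P ≤
      √(μ.real (T y : Set Y)) / √S := fun y =>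
    (integral_abs_empirical_sub_le hS hlaw hindep (Finset.measurableSet _)).trans_eq
      (Real.sqrt_div measureReal_nonneg _)
  have h2 : ∑ y ∈ R, μ.real (T y : Set Y) ≤ 1 := by
    rw [← measureReal_biUnion_finset]
    · exact measureReal_le_one
    · intro y _ z _ hyz
      refine Set.disjoint_left.2 fun x hx hx' => hyz ?_
      simp only [T, Finset.coe_map, Set.mem_image, Finset.mem_coe, Finset.mem_filter,
        Finset.mem_univ, true_and] at hx hx'
      obtain ⟨a, ha, rfl⟩ := hx
      obtain ⟨b, hb, hab⟩ := hx'
      have : b = a := Subtype.ext hab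
      rw [← ha, ← hb, this]
    · exact fun y _ => Finset.measurableSet _
  have h3 : ∑ y ∈ R, √(μ.real (T y : Set Y)) ≤ √(R.card : ℝ) := by
    refine Real.le_sqrt_of_sq_le ((sq_sum_le_card_mul_sum_sq).trans ?_)
    simp only [Real.sq_sqrt measureReal_nonneg]
    exact mul_le_of_le_one_right (Nat.cast_nonneg' _) h2
  have h4 : (S : ℝ) ^ (-(1 / 2 : ℝ)) = (√S)⁻¹ := by
    rw [Real.rpow_neg (Nat.cast_nonneg' S), Real.sqrt_eq_rpow]
  rw [h4, ← div_eq_mul_inv]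
  calc _ = ∑ y ∈ R, ∫ ω, |(empirical fun k => ξ k ω).real (T y : Set Y) -
        μ.real (T y : Set Y)| ∂P := by
        refine (Finset.sum_subset (Finset.subset_univ R) fun y _ hy => ?_).symm
        change ∫ ω, |(empirical fun k => ξ k ω).real (T y : Set Y) - μ.real (T y : Set Y)| ∂P = 0
        rw [hTR y hy]
        simp
    _ ≤ ∑ y ∈ R, √(μ.real (T y : Set Y)) / √S := Finset.sum_le_sum fun y _ => h1 y
    _ = (∑ y ∈ R, √(μ.real (T y : Set Y))) / √S := by rw [Finset.sum_div]
    _ ≤ _ := by gcongr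

/-- The term of the covering constant that belongs to `q` and `L`. -/
noncomputable def coverTerm (A : Finset Y) (t : {q : ℝ // 1 < q} × ℕ) : ℝ :=
  (t.1 : ℝ) * (((t.1 : ℝ) ^ (t.2 + 1))⁻¹ * √(A.card : ℝ) +
      ∑ l ∈ Finset.Icc 1 t.2, ((t.1 : ℝ) ^ l)⁻¹ *
        √(((Metric.coveringNumber
            (Real.toNNReal (((t.1 : ℝ) ^ l)⁻¹ * Metric.diam (A : Set Y))) (A : Set Y)).toNat : ℝ)))

lemma coverTerm_nonneg (A : Finset Y) (t : {q : ℝ // 1 < q} × ℕ) : 0 ≤ coverTerm A t := by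
  have : (0 : ℝ) < t.1 := one_pos.trans t.1.2
  unfold coverTerm
  positivity

lemma exists_coverTerm_lt (A : Finset Y) {ε : ℝ} (hε : 0 < ε) :
    ∃ t, coverTerm A t < coverConst A + ε := by
  have : Nonempty ({q : ℝ // 1 < q} × ℕ) := ⟨⟨⟨2, one_lt_two⟩, 0⟩⟩
  exact exists_lt_of_ciInf_lt (lt_add_of_pos_right _ hε)

/-- `τ` is the explicit tree bound of `transportLE_tree` rather than an optimal cost, so its
integrability is immediate and its mean is computed level by level. -/
lemma exists_transportLE_empirical (hS : 1 ≤ S) (hlaw : ∀ k, HasLaw (ξ k) μ P)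
    (hindep : iIndepFun ξ P) (K : Finset Y) (hμ : μ ∈ probOn (K : Set Y))
    (t : {q : ℝ // 1 < q} × ℕ) :
    ∃ τ : Ω → ℝ, Integrable τ P ∧ (∀ ω, 0 ≤ τ ω) ∧
      ∫ ω, τ ω ∂P ≤ Metric.diam (K : Set Y) * coverTerm K t * (S : ℝ) ^ (-(1 / 2 : ℝ)) ∧
      ∀ ω, (∀ k, ξ k ω ∈ K) →
        TransportLE (fun x : K => (empirical fun k => ξ k ω).real {(x : Y)})
          (fun x : K => μ.real {(x : Y)}) (τ ω) := by
  classical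
  obtain ⟨⟨q, hq⟩, L⟩ := t
  have hq0 : 0 < q := one_pos.trans hq
  have := hμ.1
  set D := Metric.diam (K : Set Y) with hD
  have hD0 : 0 ≤ D := Metric.diam_nonneg
  obtain ⟨x₀, hx₀⟩ := nonempty_of_mem_probOn hμ
  choose g hgd R hgR hRcard using fun l : ℕ =>
    exists_map_card_le_coveringNumber K ((q ^ l)⁻¹ * D) (by positivity)
  -- Level `l` projects to the net of radius `q ^ (-(L - l)) D`, from fine to coarse. The last map
  -- collapses everything to `x₀`, where both measures have mass `1`.
  let f : ℕ → K → K := fun l => if l < L then g (L - l) else fun _ => ⟨x₀, hx₀⟩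
  let r : ℕ → ℝ := fun l => (q ^ (L - l))⁻¹ * D
  have hr : ∀ l, 0 ≤ r l := fun l => by positivity
  have hf : ∀ l < L + 1, ∀ x, dist x (f l x) ≤ r l := by
    intro l hl x
    simp only [f, r]
    split_ifs with h
    · exact hgd _ x
    · have : L - l = 0 := by omega
      rw [this, pow_zero, inv_one, one_mul]
      exact Metric.dist_le_diam_of_mem K.finite_toSet.isBounded x.2 hx₀
  let u : Ω → K → ℝ := fun ω => (fun x : K => (empirical fun k => ξ k ω).real {(x : Y)}) -
    fun x : K => μ.real {(x : Y)}
  refine ⟨fun ω => ∑ l ∈ Finset.range (L + 1), r l * ∑ x, |push (iterComp f l) (u ω) x|,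
    integrable_finsetSum _ fun l _ => (integrable_sum_abs_push hlaw K _).const_mul _,
    fun ω => Finset.sum_nonneg fun l _ => mul_nonneg (hr l)
      (Finset.sum_nonneg fun x _ => abs_nonneg _), ?_, fun ω hω => ?_⟩
  · rw [integral_finsetSum _ fun l _ => (integrable_sum_abs_push hlaw K _).const_mul _]
    simp only [integral_const_mul]
    set c := (S : ℝ) ^ (-(1 / 2 : ℝ)) with hc
    have h0 : ∫ ω, ∑ x, |push (iterComp f 0) (u ω) x| ∂P ≤ √(K.card : ℝ) * c := by
      have := integral_sum_abs_push_le hS hlaw hindep K (iterComp f 0) Finset.univ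
        fun _ => Finset.mem_univ _
      rwa [Finset.card_univ, Fintype.card_coe] at this
    have h1 : ∀ l < L, ∫ ω, ∑ x, |push (iterComp f (l + 1)) (u ω) x| ∂P ≤
        √((R (L - l)).card : ℝ) * c := fun l hl =>
      integral_sum_abs_push_le hS hlaw hindep K (iterComp f (l + 1)) (R (L - l)) fun x => by
        change f l (iterComp f l x) ∈ _
        simp only [f, if_pos hl]
        exact hgR _ _
    -- Level `0` still sees all points of `K` and gives the `√|K|` term. Mass sitting on the net of
    -- radius `q ^ (-j) D` next moves by up to `q ^ (-(j - 1)) D`; this mismatch is the factor `q`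
    -- in front of the covering constant.
    rw [Finset.sum_range_succ']
    have h2 : ∑ l ∈ Finset.range L, r (l + 1) *
        ∫ ω, ∑ x, |push (iterComp f (l + 1)) (u ω) x| ∂P ≤
        ∑ l ∈ Finset.range L, (q ^ (L - 1 - l))⁻¹ * D * (√((R (L - 1 - l + 1)).card : ℝ) * c) := by
      refine Finset.sum_le_sum fun l hl => ?_
      have hl := Finset.mem_range.1 hl
      have e1 : L - (l + 1) = L - 1 - l := by omega
      have e2 : L - l = L - 1 - l + 1 := by omega
      simp only [r, e1]
      rw [← e2]
      exact mul_le_mul_of_nonneg_left (h1 l hl) (by positivity)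
    rw [Finset.sum_range_reflect (fun j => (q ^ j)⁻¹ * D * (√((R (j + 1)).card : ℝ) * c))] at h2
    have h3 := mul_le_mul_of_nonneg_left h0 (hr 0)
    refine (add_le_add h2 h3).trans_eq ?_
    have e3 : Finset.Icc 1 L = Finset.Ico (0 + 1) (L + 1) := by ext; simp
    simp only [coverTerm, e3, ← Finset.sum_Ico_add', ← Finset.range_eq_Ico, ← hD, ← hRcard, r,
      Nat.sub_zero]
    rw [mul_add, mul_add, add_mul, add_comm, Finset.mul_sum, Finset.mul_sum, Finset.sum_mul]
    congr 1
    · field_simp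
      ring
    · refine Finset.sum_congr rfl fun l _ => ?_
      field_simp
      ring
  · have hemp := empirical_mem_probOn hS (x := fun k => ξ k ω) K.measurableSet hω
    refine transportLE_tree (L + 1) f r hf _ _ (fun x => measureReal_nonneg)
      (fun x => measureReal_nonneg) ?_
    have hconst : iterComp f (L + 1) = fun _ => ⟨x₀, hx₀⟩ := by
      ext x
      change (f L (iterComp f L x) : Y) = _
      simp [f]
    ext y
    rw [hconst]
    simp only [push]
    by_cases hy : (⟨x₀, hx₀⟩ : K) = y
    · simp only [hy, if_true, sum_measureReal_of_mem_probOn hμ, sum_measureReal_of_mem_probOn hemp]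
    · simp [hy]

end Covering

end WassersteinBarycenter

namespace WassersteinBarycenter

section Stability

variable {Y : Type*} [MetricSpace Y] [MeasurableSpace Y] [BorelSpace Y] {N : ℕ} {p : ℝ}
  {C : Finset Y} {s : Fin N → Finset Y} {m m' : Fin N → Measure Y}

/-! ### Stability of the linear program -/

/-- Changing the marginals changes the cost by at most `p D ^ (p - 1)` times the transport cost. -/
lemma exists_mem_lpFeasible_of_transportLE (hp : 1 ≤ p) {D : ℝ} (hD0 : 0 ≤ D)
    (hD : ∀ i, ∀ x ∈ s i, ∀ c ∈ C, dist c x ≤ D) {T : Fin N → ℝ}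
    (hT : ∀ i, TransportLE (fun x : s i => (m' i).real {(x : Y)})
      (fun x : s i => (m i).real {(x : Y)}) (T i))
    {z' : LPVar C s} (hz' : z' ∈ lpFeasible C s m') :
    ∃ z ∈ lpFeasible C s m, z.2 = z'.2 ∧
      lpCost p C s z ≤ lpCost p C s z' + p * D ^ (p - 1) * ((∑ i, T i) / N) := by
  have h : ∀ i, ∃ η : C → s i → ℝ, IsPlan η z'.2 (fun k => (m i).real {(k : Y)}) ∧
      ∑ j, ∑ k, η j k * dist (j : Y) (k : Y) ^ p ≤
        ∑ j, ∑ k, z'.1 i j k * dist (j : Y) (k : Y) ^ p + p * D ^ (p - 1) * T i := by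
    intro i
    obtain ⟨γ, hγ, hγT⟩ := hT i
    -- The plan from `C` to `s i` is continued by the one that corrects the marginal. The side on
    -- `C`, hence the weights, is untouched.
    obtain ⟨η, hη, hηc⟩ := (mem_lpFeasible_iff.1 hz' i).symm.trans hγ
      (c₁ := fun j k => dist (j : Y) (k : Y) ^ p) (c₂ := fun k l => p * D ^ (p - 1) * dist k l)
      (c₃ := fun j l => dist (j : Y) (l : Y) ^ p) fun j k l =>
        rpow_le_rpow_add hp dist_nonneg (hD i l l.2 j j.2) dist_nonneg dist_nonneg
          (dist_triangle (j : Y) (k : Y) (l : Y))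
    refine ⟨η, hη, hηc.trans (add_le_add le_rfl ?_)⟩
    calc _ = p * D ^ (p - 1) * ∑ k, ∑ l, γ k l * dist k l := by
          simp only [Finset.mul_sum]
          exact Finset.sum_congr rfl fun k _ => Finset.sum_congr rfl fun l _ => by ring
      _ ≤ _ := by gcongr
  choose η hη hηc using h
  refine ⟨(η, z'.2), mem_lpFeasible_iff.2 fun i => (hη i).symm, rfl, ?_⟩
  simp only [lpCost]
  calc _ ≤ (1 / (N : ℝ)) * ∑ i, (∑ j : C, ∑ k : s i, z'.1 i j k * dist (j : Y) (k : Y) ^ p +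
        p * D ^ (p - 1) * T i) := by
        gcongr with i
        exact hηc i
    _ = _ := by
        rw [Finset.sum_add_distrib, ← Finset.mul_sum]
        ring

/-- Every barycenter of `m'` is close to a barycenter of `m`. -/
lemma exists_barycenter_close (hp : 1 ≤ p) (hN : 1 ≤ N)
    (hm : ∀ i, m i ∈ probOn (s i : Set Y)) (hm' : ∀ i, m' i ∈ probOn (s i : Set Y)) {D : ℝ}
    (hD0 : 0 < D) (hD : ∀ i, ∀ x ∈ s i, ∀ c ∈ C, dist c x ≤ D)
    (hDC : ∀ x ∈ C, ∀ c ∈ C, dist x c ≤ D) {T : Fin N → ℝ}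
    (hT : ∀ i, TransportLE (fun x : s i => (m' i).real {(x : Y)})
      (fun x : s i => (m i).real {(x : Y)}) (T i))
    (hslope : 0 < lpSlope p C s m) {ν : Measure Y} (hν : ν ∈ barycenters p (C : Set Y) m') :
    ∃ ρ ∈ barycenters p (C : Set Y) m, wasserstein p ρ ν ^ p ≤
      ENNReal.ofReal (p * D ^ (p - 1) * ((∑ i, T i) / N) / lpConst p D C s m) := by
  have hCne := nonempty_of_mem_probOn hν.1
  obtain ⟨zS, hzS, rfl⟩ := (mem_barycenters_finset_iff hp hN hm').1 hν
  set ε := p * D ^ (p - 1) * ((∑ i, T i) / N)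
  obtain ⟨z, hz, hz2, hzc⟩ := exists_mem_lpFeasible_of_transportLE hp hD0.le hD hT hzS.1
  obtain ⟨x, hx⟩ := lpMinimisers_nonempty (p := p) hN hm hCne
  -- A true minimiser carried over to the empirical program, to compete there with `zS`.
  obtain ⟨xS, hxS, -, hxSc⟩ := exists_mem_lpFeasible_of_transportLE hp hD0.le hD
    (fun i => (hT i).symm) hx.1
  obtain ⟨y, hy, hyc⟩ := exists_lpSlope_mul_lpDist_le (p := p) hN hm hCne hz
  -- One `ε` for passing from `zS` to `z`, one for passing from `x` to `xS`.
  have h1 : lpCost p C s z - lpValue p C s m ≤ 2 * ε := by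
    have := hzS.2 xS hxS
    rw [← lpCost_eq_lpValue hx]
    linarith
  have h2 := mul_le_mul_of_nonneg_left (mul_sum_abs_le_lpDist hz hy.1) hslope.le
  refine ⟨_, (mem_barycenters_finset_iff hp hN hm).2 ⟨y, hy, rfl⟩, ?_⟩
  refine (wasserstein_atomic_le_sum_abs hp C (snd_nonneg_of_mem_lpFeasible hN hy.1)
    (snd_nonneg_of_mem_lpFeasible hN hzS.1) ?_ hDC).trans (ENNReal.ofReal_le_ofReal ?_)
  · rw [sum_snd_of_mem_lpFeasible hN hm hy.1, sum_snd_of_mem_lpFeasible hN hm' hzS.1]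
  · have hconst : lpConst p D C s m = ((N : ℝ) + 1) * (D ^ p)⁻¹ * lpSlope p C s m := by
      rw [lpConst, lpSlope, Real.rpow_neg hD0.le]
    have hDp : 0 < D ^ p := Real.rpow_pos_of_pos hD0 p
    have hN1 : (0 : ℝ) < (N : ℝ) + 1 := by positivity
    rw [hconst, le_div_iff₀ (by positivity), ← hz2]
    have h3 : ∑ j, |y.2 j - z.2 j| = ∑ j, |z.2 j - y.2 j| :=
      Finset.sum_congr rfl fun j _ => abs_sub_comm _ _
    rw [h3]
    have h4 : D ^ p * ((∑ j, |z.2 j - y.2 j|) / 2) * ((N + 1) * (D ^ p)⁻¹ * lpSlope p C s m) =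
        lpSlope p C s m * (((N : ℝ) + 1) * ∑ j, |z.2 j - y.2 j|) / 2 := by
      field_simp
    rw [h4]
    linarith

/-! ### Degenerate cases and supports -/

lemma wasserstein_self (hp : 1 ≤ p) {ν : Measure Y} (hν : ν ∈ probOn (C : Set Y)) :
    wasserstein p ν ν ^ p = 0 := by
  have h := wasserstein_atomic_le_sum_abs (p := p) hp C
    (a := fun j => ν.real {(j : Y)}) (b := fun j => ν.real {(j : Y)})
    (fun _ => measureReal_nonneg) (fun _ => measureReal_nonneg) rfl (D := Metric.diam (C : Set Y))
    fun x hx y hy => Metric.dist_le_diam_of_mem C.finite_toSet.isBounded hx hy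
  simpa [atomic_of_mem_probOn hν] using h

/-- If every vertex is optimal then so is every feasible point, and each probability measure on `C`
is the weight part of one. -/
lemma mem_barycenters_of_lpNonoptVertices_eq_empty (hp : 1 ≤ p) (hN : 1 ≤ N)
    (hm : ∀ i, m i ∈ probOn (s i : Set Y)) (h : lpNonoptVertices p C s m = ∅) {ν : Measure Y}
    (hν : ν ∈ probOn (C : Set Y)) : ν ∈ barycenters p (C : Set Y) m := by
  obtain ⟨z, hz, hzν, -⟩ := exists_mem_lpFeasible_le_frechet (p := p) hp hN hm hν
  exact (mem_barycenters_finset_iff hp hN hm).2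
    ⟨z, lpFeasible_subset_lpMinimisers hN hm h hz, hzν⟩

/-- If `D ≤ 0`, all distances between `C` and the supports vanish and so does the objective, which
leaves no non-optimal vertex. This makes `Δ ^ (-p)` in `C_P` meaningful. -/
lemma pos_of_lpNonoptVertices_nonempty (hp : 1 ≤ p) {D : ℝ}
    (hD : ∀ i, ∀ x ∈ s i, ∀ c ∈ C, dist c x ≤ D) (h : (lpNonoptVertices p C s m).Nonempty) :
    0 < D := by
  by_contra hD0
  rw [not_lt] at hD0
  obtain ⟨v, hv, hv'⟩ := h
  have h0 : ∀ z : LPVar C s, lpCost p C s z = 0 := fun z => by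
    rw [lpCost, Finset.sum_eq_zero, mul_zero]
    refine fun i _ => Finset.sum_eq_zero fun j _ => Finset.sum_eq_zero fun k _ => ?_
    rw [le_antisymm ((hD i k k.2 j j.2).trans hD0) dist_nonneg, Real.zero_rpow (by linarith),
      mul_zero]
  exact hv' ⟨extremePoints_subset hv, fun w _ => by rw [h0, h0]⟩

lemma mem_probOn_supp {X : Finset Y} {μ : Measure Y} (hμ : μ ∈ probOn (X : Set Y)) :
    μ ∈ probOn (supp X μ : Set Y) := by
  classical
  refine ⟨hμ.1, measure_mono_null (t := (X : Set Y)ᶜ ∪ (X.filter fun x => μ {x} = 0 : Finset Y))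
    (fun x hx => ?_) (measure_union_null hμ.2 ?_)⟩
  · by_cases hxX : x ∈ X
    · right
      by_contra h
      refine hx ?_
      simp only [Finset.coe_filter, Set.mem_ofPred_eq, not_and] at h
      simpa [supp, hxX] using h hxX
    · exact Or.inl hxX
  · rw [← sum_measure_singleton]
    exact Finset.sum_eq_zero fun x hx => (Finset.mem_filter.1 hx).2

/-! ### Centroids in a convex subset of a Euclidean space -/

/-- A point outside the convex hull of `X` is no centroid, because its projection onto the hull is
strictly closer to every point of `X`. Taking the hull does not increase the diameter. -/
lemma diam_union_centroids_eq (hp : 1 ≤ p) (hN : 1 ≤ N) (hY : IsConvexEuclidean Y) (X : Finset Y)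
    (hs : ∀ i, s i ⊆ X) (hC : (C : Set Y) ⊆ centroidSet p s) :
    Metric.diam ((X : Set Y) ∪ C) = Metric.diam (X : Set Y) := by
  obtain ⟨D, f, hf, hconv⟩ := hY
  refine le_antisymm ?_ (Metric.diam_mono Set.subset_union_left
    (X.finite_toSet.union C.finite_toSet).isBounded)
  have hfin : (f '' (X : Set Y)).Finite := X.finite_toSet.image f
  have hKc : IsCompact (convexHull ℝ (f '' (X : Set Y))) := hfin.isCompact_convexHull ℝ
  -- Convexity of the range makes the projection the image of a point of `Y`, hence a competitor for
  -- the centroid.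
  have hKr : convexHull ℝ (f '' (X : Set Y)) ⊆ Set.range f :=
    convexHull_min (Set.image_subset_range _ _) hconv
  have hXK : f '' (X : Set Y) ⊆ convexHull ℝ (f '' (X : Set Y)) := subset_convexHull ℝ _
  have hCK : f '' (C : Set Y) ⊆ convexHull ℝ (f '' (X : Set Y)) := by
    rintro _ ⟨y, hy, rfl⟩
    obtain ⟨x, hx, hcent⟩ := hC hy
    have hxK : ∀ i, f (x i) ∈ convexHull ℝ (f '' (X : Set Y)) := fun i =>
      hXK ⟨x i, hs i (hx i), rfl⟩
    by_contra hyK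
    obtain ⟨v, hv, hvmin⟩ := exists_norm_eq_iInf_of_complete_convex ⟨_, hxK ⟨0, hN⟩⟩
      hKc.isComplete (convex_convexHull ℝ _) (f y)
    rw [norm_eq_iInf_iff_real_inner_le_zero (convex_convexHull ℝ _) hv] at hvmin
    obtain ⟨y', rfl⟩ := hKr hv
    have hne : 0 < ‖f y - f y'‖ := norm_pos_iff.2 (sub_ne_zero.2 fun h => hyK (h ▸ hv))
    have hlt : ∀ i, dist (x i) y' < dist (x i) y := by
      intro i
      rw [← hf.dist_eq, ← hf.dist_eq, dist_eq_norm, dist_eq_norm]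
      refine lt_of_pow_lt_pow_left₀ 2 (norm_nonneg _) ?_
      have e : f (x i) - f y = (f (x i) - f y') - (f y - f y') := by abel
      have h1 := norm_sub_sq_real (f (x i) - f y') (f y - f y')
      have h2 := hvmin _ (hxK i)
      rw [real_inner_comm] at h2
      rw [e, h1]
      nlinarith
    refine absurd (hcent y') (not_le.2 ?_)
    exact Finset.sum_lt_sum_of_nonempty ⟨⟨0, hN⟩, Finset.mem_univ _⟩ fun i _ =>
      Real.rpow_lt_rpow dist_nonneg (hlt i) (by linarith)
  calc Metric.diam ((X : Set Y) ∪ C) = Metric.diam (f '' ((X : Set Y) ∪ C)) :=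
        (hf.diam_image _).symm
    _ ≤ Metric.diam (convexHull ℝ (f '' (X : Set Y))) := by
        rw [Set.image_union]
        exact Metric.diam_mono (Set.union_subset hXK hCK) hKc.isBounded
    _ = Metric.diam (X : Set Y) := by rw [convexHull_diam, hf.diam_image]

end Stability

end WassersteinBarycenter

namespace WassersteinBarycenter

/-! ### The expected error of the empirical barycenters -/

section Error

variable {Y : Type*} [MetricSpace Y] [MeasurableSpace Y] [BorelSpace Y] {N : ℕ} {p : ℝ}
  {C : Finset Y} {s : Fin N → Finset Y} {μ : Fin N → Measure Y}
  {Ω : Type*} [MeasurableSpace Ω] {P : Measure Ω} [IsProbabilityMeasure P] {S : ℕ}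
  {ξ : Fin N → Fin S → Ω → Y}

/-- Thanks to this the empirical program almost surely has the same variables as the true one and
differs only in its marginals. -/
lemma ae_forall_mem_of_hasLaw (hμ : ∀ i, μ i ∈ probOn (s i : Set Y))
    (hlaw : ∀ i k, HasLaw (ξ i k) (μ i) P) : ∀ᵐ ω ∂P, ∀ i k, ξ i k ω ∈ s i := by
  refine ae_all_iff.2 fun i => ae_all_iff.2 fun k => ?_
  refine ae_of_ae_map (p := (· ∈ s i)) (hlaw i k).aemeasurable ?_
  rw [(hlaw i k).map_eq]
  exact (hμ i).2

/-- The expected error of the barycenters of the empirical measures, with the covering constants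
replaced by any of the terms of which they are the infimum. -/
lemma lintegral_error_le (hp : 1 ≤ p) (hN : 1 ≤ N) (hS : 1 ≤ S)
    (hμ : ∀ i, μ i ∈ probOn (s i : Set Y)) (hlaw : ∀ i k, HasLaw (ξ i k) (μ i) P)
    (hindep : ∀ i, iIndepFun (ξ i) P) {D : ℝ} (hD0 : 0 < D)
    (hD : ∀ i, ∀ x ∈ s i, ∀ c ∈ C, dist c x ≤ D) (hDC : ∀ x ∈ C, ∀ c ∈ C, dist x c ≤ D)
    (hDs : ∀ i, Metric.diam (s i : Set Y) ≤ D) (hslope : 0 < lpSlope p C s μ)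
    (hconst : 0 < lpConst p D C s μ) (t : Fin N → {q : ℝ // 1 < q} × ℕ) :
    ∫⁻ ω, ⨆ ν ∈ barycenters p (C : Set Y) (fun i => empirical fun k => ξ i k ω),
      ⨅ ρ ∈ barycenters p (C : Set Y) μ, wasserstein p ρ ν ^ p ∂P ≤
    ENNReal.ofReal (p * ((∑ i, coverTerm (s i) (t i)) / N) * D ^ p / lpConst p D C s μ *
      (S : ℝ) ^ (-(1 / 2 : ℝ))) := by
  choose τ hτi hτ0 hτb hτ using fun i =>
    exists_transportLE_empirical hS (hlaw i) (hindep i) (s i) (hμ i) (t i)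
  have hint : Integrable (fun ω => p * D ^ (p - 1) * ((∑ i, τ i ω) / N) / lpConst p D C s μ) P :=
    (((integrable_finsetSum _ fun i _ => hτi i).div_const _).const_mul _).div_const _
  calc _ ≤ ∫⁻ ω, ENNReal.ofReal
        (p * D ^ (p - 1) * ((∑ i, τ i ω) / N) / lpConst p D C s μ) ∂P := by
        -- The supremum over the barycenters need not be measurable; a pointwise bound by the
        -- integrable majorant suffices.
        refine lintegral_mono_ae ?_
        filter_upwards [ae_forall_mem_of_hasLaw hμ hlaw] with ω hω
        refine iSup₂_le fun ν hν => ?_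
        obtain ⟨ρ, hρ, hle⟩ := exists_barycenter_close hp hN hμ
          (fun i => empirical_mem_probOn hS (s i).measurableSet (hω i)) hD0 hD hDC
          (fun i => hτ i ω (hω i)) hslope hν
        exact (iInf₂_le ρ hρ).trans hle
    _ = ENNReal.ofReal
        (∫ ω, p * D ^ (p - 1) * ((∑ i, τ i ω) / N) / lpConst p D C s μ ∂P) := by
        refine (ofReal_integral_eq_lintegral_ofReal hint
          (Filter.Eventually.of_forall fun ω => ?_)).symm
        have : 0 ≤ ∑ i, τ i ω := Finset.sum_nonneg fun i _ => hτ0 i ω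
        dsimp only [Pi.zero_apply]
        positivity
    _ ≤ _ := by
        refine ENNReal.ofReal_le_ofReal ?_
        rw [integral_div, integral_const_mul, integral_div,
          integral_finsetSum _ fun i _ => hτi i]
        have hsum : ∑ i, ∫ ω, τ i ω ∂P ≤
            D * (∑ i, coverTerm (s i) (t i)) * (S : ℝ) ^ (-(1 / 2 : ℝ)) := by
          rw [Finset.mul_sum, Finset.sum_mul]
          refine Finset.sum_le_sum fun i _ => (hτb i).trans ?_
          have := coverTerm_nonneg (s i) (t i)
          gcongr
          exact hDs i
        calc _ ≤ p * D ^ (p - 1) * ((D * (∑ i, coverTerm (s i) (t i)) *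
              (S : ℝ) ^ (-(1 / 2 : ℝ))) / N) / lpConst p D C s μ := by gcongr
          _ = _ := by
              rw [Real.rpow_sub_one hD0.ne']
              field_simp

/-- The infimum in the covering constant need not be attained, so terms within `ε` of it are used
and `ε` tends to `0`. -/
lemma lintegral_error_le_avgCoverConst (hp : 1 ≤ p) (hN : 1 ≤ N) (hS : 1 ≤ S)
    (hμ : ∀ i, μ i ∈ probOn (s i : Set Y)) (hlaw : ∀ i k, HasLaw (ξ i k) (μ i) P)
    (hindep : ∀ i, iIndepFun (ξ i) P) {D : ℝ} (hD0 : 0 < D)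
    (hD : ∀ i, ∀ x ∈ s i, ∀ c ∈ C, dist c x ≤ D) (hDC : ∀ x ∈ C, ∀ c ∈ C, dist x c ≤ D)
    (hDs : ∀ i, Metric.diam (s i : Set Y) ≤ D) (hslope : 0 < lpSlope p C s μ)
    (hconst : 0 < lpConst p D C s μ) :
    ∫⁻ ω, ⨆ ν ∈ barycenters p (C : Set Y) (fun i => empirical fun k => ξ i k ω),
      ⨅ ρ ∈ barycenters p (C : Set Y) μ, wasserstein p ρ ν ^ p ∂P ≤
    ENNReal.ofReal (p * avgCoverConst s * D ^ p / lpConst p D C s μ *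
      (S : ℝ) ^ (-(1 / 2 : ℝ))) := by
  have hlim : Filter.Tendsto (fun ε : ℝ => ENNReal.ofReal
      (p * ((∑ i, (coverConst (s i) + ε)) / N) * D ^ p / lpConst p D C s μ *
        (S : ℝ) ^ (-(1 / 2 : ℝ)))) (nhdsWithin 0 (Set.Ioi 0)) (nhds (ENNReal.ofReal
      (p * ((∑ i, (coverConst (s i) + 0)) / N) * D ^ p / lpConst p D C s μ *
        (S : ℝ) ^ (-(1 / 2 : ℝ))))) := by
    refine (Continuous.tendsto ?_ 0).mono_left nhdsWithin_le_nhds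
    exact ENNReal.continuous_ofReal.comp (by fun_prop)
  simp only [add_zero] at hlim
  refine ge_of_tendsto hlim ?_
  filter_upwards [self_mem_nhdsWithin] with ε hε
  choose t ht using fun i => exists_coverTerm_lt (s i) (Set.mem_Ioi.1 hε)
  refine (lintegral_error_le hp hN hS hμ hlaw hindep hD0 hD hDC hDs hslope hconst t).trans
    (ENNReal.ofReal_le_ofReal ?_)
  gcongr with i
  exact (ht i).le

end Error

end WassersteinBarycenter

theorem theorem3p2
    {Y : Type*} [MetricSpace Y] [MeasurableSpace Y] [BorelSpace Y]
    {Ω : Type*} [MeasurableSpace Ω] (P : Measure Ω) [IsProbabilityMeasure P]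
    (p : ℝ) (hp : 1 ≤ p) (N S : ℕ) (hN : 1 ≤ N) (hS : 1 ≤ S)
    -- the data: probability measures on the finite set `X`
    (X : Finset Y) (μ : Fin N → Measure Y) (hμ : ∀ i, μ i ∈ probOn (X : Set Y))
    -- `S` i.i.d. draws from every `μ i`
    (ξ : Fin N → Fin S → Ω → Y) (hlaw : ∀ i k, HasLaw (ξ i k) (μ i) P)
    (hindep : ∀ i, iIndepFun (ξ i) P)
    -- the finite set of centroids: at least one for every choice of support points
    (C : Finset Y)
    (hC : (C : Set Y) ⊆ centroidSet p (fun i => supp X (μ i)))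
    (hC' : ∀ x : Fin N → Y, (∀ i, x i ∈ supp X (μ i)) → ∃ c ∈ C, IsCentroid p x c)
    -- barycenters are sought among the measures on `C`, or, if `C` is the set of all
    -- the centroids, among all the measures on `Y`
    (A : Set Y)
    (hA : A = (C : Set Y) ∨
      (A = Set.univ ∧ (C : Set Y) = centroidSet p (fun i => supp X (μ i))))
    (Δ : ℝ) (hΔ : Δ = Metric.diam ((X : Set Y) ∪ (C : Set Y))) :
    let s : Fin N → Finset Y := fun i => supp X (μ i)
    let emp : Ω → Fin N → Measure Y := fun ω i => empirical (fun k => ξ i k ω)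
    let err : ℝ≥0∞ :=
      ∫⁻ ω, ⨆ ν ∈ barycenters p A (emp ω), ⨅ ρ ∈ barycenters p A μ, wasserstein p ρ ν ^ p ∂P
    let CP : ℝ := lpConst p Δ C s μ
    -- barycenters exist
    ((barycenters p A μ).Nonempty ∧ ∀ᵐ ω ∂P, (barycenters p A (emp ω)).Nonempty) ∧
    -- the bound
    ((lpNonoptVertices p C s μ).Nonempty →
      0 < CP ∧ err ≤ ENNReal.ofReal (p * avgCoverConst s * Δ ^ p / CP * (S : ℝ) ^ (-(1 / 2 : ℝ)))) ∧
    -- if all the vertices are optimal, the minimum in `CP` is `+∞` and the bound is zero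
    (lpNonoptVertices p C s μ = ∅ → err = 0) ∧
    -- in a Euclidean space `Δ` is the diameter of `X`
    (IsConvexEuclidean Y → Δ = Metric.diam (X : Set Y)) := by

  intro s emp err CP
  have hμs : ∀ i, μ i ∈ probOn (s i : Set Y) := fun i => mem_probOn_supp (hμ i)
  have hsX : ∀ i, s i ⊆ X := fun i => Finset.filter_subset _ _
  have hbdd : Bornology.IsBounded ((X : Set Y) ∪ (C : Set Y)) :=
    (X.finite_toSet.union C.finite_toSet).isBounded
  have hD : ∀ i, ∀ x ∈ s i, ∀ c ∈ C, dist c x ≤ Δ := fun i x hx c hc =>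
    hΔ ▸ Metric.dist_le_diam_of_mem hbdd (Or.inr hc) (Or.inl (hsX i hx))
  have hDC : ∀ x ∈ C, ∀ c ∈ C, dist x c ≤ Δ := fun x hx c hc =>
    hΔ ▸ Metric.dist_le_diam_of_mem hbdd (Or.inr hx) (Or.inr hc)
  have hDs : ∀ i, Metric.diam (s i : Set Y) ≤ Δ := fun i =>
    hΔ ▸ Metric.diam_mono (fun x hx => Or.inl (hsX i hx)) hbdd
  have hne : ∀ i, Nonempty (s i) := fun i => (nonempty_of_mem_probOn (hμs i)).to_subtype
  have hCne : C.Nonempty := by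
    obtain ⟨c, hc, -⟩ := hC' (fun i => (Classical.arbitrary (s i) : s i))
      fun i => (Classical.arbitrary (s i)).2
    exact ⟨c, hc⟩
  -- Only concentration on the true supports is required, so the same `C` serves `μ` and, almost
  -- surely, the empirical measures.
  have hbary : ∀ m : Fin N → Measure Y, (∀ i, m i ∈ probOn (s i : Set Y)) →
      barycenters p A m = barycenters p (C : Set Y) m := by
    intro m hm
    rcases hA with rfl | ⟨rfl, hCall⟩
    · rfl
    · exact barycenters_univ_eq hp hN hm hCall hC'
  have hnonempty : ∀ m : Fin N → Measure Y, (∀ i, m i ∈ probOn (s i : Set Y)) →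
      (barycenters p A m).Nonempty := by
    intro m hm
    rw [hbary m hm]
    obtain ⟨z, hz⟩ := lpMinimisers_nonempty (p := p) hN hm hCne
    exact ⟨_, (mem_barycenters_finset_iff hp hN hm).2 ⟨z, hz, rfl⟩⟩
  have hae : ∀ᵐ ω ∂P, ∀ i, emp ω i ∈ probOn (s i : Set Y) := by
    filter_upwards [ae_forall_mem_of_hasLaw hμs hlaw] with ω hω i
    exact empirical_mem_probOn hS (s i).measurableSet (hω i)
  have herr : err = ∫⁻ ω, ⨆ ν ∈ barycenters p (C : Set Y) (emp ω),
      ⨅ ρ ∈ barycenters p (C : Set Y) μ, wasserstein p ρ ν ^ p ∂P := by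
    refine lintegral_congr_ae ?_
    filter_upwards [hae] with ω hω
    rw [hbary _ hω, hbary _ hμs]
  refine ⟨⟨hnonempty μ hμs, hae.mono fun ω hω => hnonempty _ hω⟩, fun hV => ?_, fun hV => ?_,
    fun hY => ?_⟩
  · have hΔ0 : 0 < Δ := pos_of_lpNonoptVertices_nonempty hp hD hV
    have hslope : 0 < lpSlope p C s μ := lpSlope_pos hN hμs hCne hV
    have hCP : 0 < CP :=
      mul_pos (mul_pos (by positivity) (Real.rpow_pos_of_pos hΔ0 _)) hslope
    refine ⟨hCP, ?_⟩
    rw [herr]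
    exact lintegral_error_le_avgCoverConst hp hN hS hμs hlaw hindep hΔ0 hD hDC hDs hslope hCP
  · rw [herr, lintegral_eq_zero_of_ae_eq_zero]
    filter_upwards [hae] with ω hω
    refine le_antisymm (iSup₂_le fun ν hν => ?_) bot_le
    exact (iInf₂_le ν (mem_barycenters_of_lpNonoptVertices_eq_empty hp hN hμs hV hν.1)).trans
      (wasserstein_self hp hν.1).le
  · rw [hΔ]
    exact diam_union_centroids_eq hp hN hY X hsX hC
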